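/- Let $\Delta(y)=y_1^2-y_2^2-y_3^2$ on $\mathbb R^3$, let $\Lambda_3=\{y\in\mathbb R^3:\Delta(y)>0,\ y_1>0\}$ be the Lorentz cone, $T_{\Lambda_3}=\mathbb R^3+i\Lambda_3\subset\mathbb C^3$ the tube domain over it, and $\Pi^+=\{z\in\mathbb C:\Im z>0\}$. Let $H^2(T_{\Lambda_3})$ be the space of holomorphic functions $F$ on $T_{\Lambda_3}$ with $$\|F\|_{H^2(T_{\Lambda_3})}=\Big(\sup_{y\in\Lambda_3}\int_{\mathbb R^3}|F(x+iy)|^2\,dx\Big)^{1/2}<\infty,$$ and, for $\alpha>-1$, let $A^2_\alpha(\Pi^+)$ be the space of holomorphic functions $G$ on $\Pi^+$ with $$\|G\|_{A^2_\alpha(\Pi^+)}=\Big(\int_{\Pi^+}|G(x+iy)|^2\,y^\alpha\,dx\,dy\Big)^{1/2}<\infty.$$ Let $\Box=\Delta\big(\tfrac1i\tfrac{\partial}{\partial x}\big)=-\big(\partial_{x_1}^2-\partial_{x_2}^2-\partial_{x_3}^2\big)$, and for a function $F$ on $T_{\Lambda_3}$ put $(RF)(z_1)=F(z_1,0,0)$,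 $z_1\in\Pi^+$. Let $m\ge 0$ be an integer. (1) For every $F\in H^2(T_{\Lambda_3})$, the function $R\Box^mF$ belongs to $A^2_{4m+1}(\Pi^+)$ and $$\|R\Box^mF\|^2_{A^2_{4m+1}(\Pi^+)}\le\frac{\Gamma(4m+2)}{2^{4m+4}\,\pi\,(2m+1)}\,\|F\|^2_{H^2(T_{\Lambda_3})}.$$ (2) Conversely, for every $G\in A^2_{4m+1}(\Pi^+)$ there exists $F\in H^2(T_{\Lambda_3})$ such that $R\Box^mF=G$ on $\Pi^+$ and $$\|F\|_{H^2(T_{\Lambda_3})}=2^{2m+2}(m+1)\sqrt{\frac{\pi}{\Gamma(4m+2)}}\;\|G\|_{A^2_{4m+1}(\Pi^+)}.$$ -/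

import Mathlib

open scoped ENNReal

noncomputable section

/-- The determinant function (Lorentz form) `Δ(y) = y₁² - y₂² - y₃²` on `ℝ³`. -/
def lorentzForm (y : Fin 3 → ℝ) : ℝ := y 0 ^ 2 - y 1 ^ 2 - y 2 ^ 2

/-- The Lorentz (forward light) cone `Λ₃ = {y ∈ ℝ³ : Δ(y) > 0, y₁ > 0}`. -/
def lorentzCone : Set (Fin 3 → ℝ) := {y | 0 < lorentzForm y ∧ 0 < y 0}

/-- The tube domain `T_Ω = ℝⁿ + iΩ`. -/
def tubeDomain {n : ℕ} (Ω : Set (Fin n → ℝ)) : Set (Fin n → ℂ) := {z | (fun j => (z j).im) ∈ Ω}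

/-- The `H²(T_Ω)` norm `(sup_{y ∈ Ω} ∫_{ℝⁿ} |F(x + iy)|² dx)^{1/2}`, with values in `[0, ∞]`. -/
def hardyENorm {n : ℕ} (Ω : Set (Fin n → ℝ)) (F : (Fin n → ℂ) → ℂ) : ℝ≥0∞ :=
  (⨆ y ∈ Ω, ∫⁻ x : Fin n → ℝ, ‖F (fun j => (x j : ℂ) + Complex.I * (y j : ℂ))‖ₑ ^ 2) ^ (1 / 2 : ℝ)

/-- `F` is, on `T_Ω`, a member of the Hardy space `H²(T_Ω)` (values off `T_Ω` are irrelevant). -/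
def MemHardy {n : ℕ} (Ω : Set (Fin n → ℝ)) (F : (Fin n → ℂ) → ℂ) : Prop :=
  DifferentiableOn ℂ F (tubeDomain Ω) ∧ hardyENorm Ω F < ∞

/-- The open upper half-plane `Π⁺`. -/
def upperHalf : Set ℂ := {z | 0 < z.im}

/-- The `A²_α(Π⁺)` norm `(∫_{Π⁺} |G(x + iy)|² y^α dx dy)^{1/2}`, with values in `[0, ∞]`. -/
def bergmanENorm (α : ℝ) (G : ℂ → ℂ) : ℝ≥0∞ :=
  (∫⁻ z in upperHalf, ‖G z‖ₑ ^ 2 * ENNReal.ofReal (z.im ^ α)) ^ (1 / 2 : ℝ)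

/-- `G` is, on `Π⁺`, a member of the weighted Bergman space `A²_α(Π⁺)`. -/
def MemBergman (α : ℝ) (G : ℂ → ℂ) : Prop :=
  DifferentiableOn ℂ G upperHalf ∧ bergmanENorm α G < ∞

/-- The operator `(1/i) ∂/∂x_j` acting on functions of `z = x + iy ∈ ℂ³`. -/
def momentum (j : Fin 3) (F : (Fin 3 → ℂ) → ℂ) (z : Fin 3 → ℂ) : ℂ :=
  (1 / Complex.I) * lineDeriv ℝ F z (Pi.single j 1)

/-- The Box operator `□ = Δ((1/i) ∂/∂x)` of `Λ₃`. -/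
def boxOp (F : (Fin 3 → ℂ) → ℂ) (z : Fin 3 → ℂ) : ℂ :=
  momentum 0 (momentum 0 F) z - momentum 1 (momentum 1 F) z - momentum 2 (momentum 2 F) z

/-- The restriction `(RF)(z₁) = F(z₁, 0, 0)`. -/
def restrictFirst (F : (Fin 3 → ℂ) → ℂ) (z : ℂ) : ℂ := F ![z, 0, 0]

end

/-! Everything is read off on the Fourier side. Write a point of `ℝ³` as `p = (t, ζ)` with `t` real
and `ζ` complex, so that the cone is `‖ζ‖ < t`.

Paley–Wiener (`exists_laplace_of_memHardy`, `memHardy_laplace`): `H²` of the tube consists of the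
transforms `∫ e^{2πi z·p} f(p) dp` with `f ∈ L²` carried by the closed cone, and the norms agree. On
such transforms `□` multiplies `f` by `(2π)²(t² - ‖ζ‖²)`, and restriction to `(z₁, 0, 0)` integrates
out `ζ`. Hence `R □ᵐ F` is the one-variable transform of `g(t) = (2π)^{2m} ∫_{‖ζ‖ ≤ t} (t² - ‖ζ‖²)^m
f(t, ζ) dζ`. On the half-plane side, Plancherel on each line followed by the Gamma integral in `y`
gives the squared norm in `A²_{4m+1}` as `Γ(4m+2) / (4π)^{4m+2}` times `∫ |g|² t^{-(4m+2)} dt`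
(`Density.bergmanENorm_sq`), and every Bergman function has such a density
(`exists_density_of_memBergman`).

Part (1) is then Cauchy–Schwarz on each disc `‖ζ‖ ≤ t`, using `∫ (t² - ‖ζ‖²)^{2m} dζ = π t^{4m+2} /
(2m+1)`. For part (2) take `f` constant in `ζ`, namely `f(t, ζ) = c g(t) / t^{2m+2}` on the cone,
with `c` fixed by `∫ (t² - ‖ζ‖²)^m dζ = π t^{2m+2} / (m+1)`. Equality in Cauchy–Schwarz would
require `f` proportional to `(t² - ‖ζ‖²)^m` on each disc, so for `m > 0` this extension is not the
one of least norm.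

Both Paley–Wiener theorems rest on `fourier_slice_eq`: Fourier transforms of parallel slices differ
by a real exponential. Undoing that exponential gives one function `f` for all heights, and the norm
bounds then force its support and integrability. -/

namespace LorentzHardy

open MeasureTheory FourierTransform SchwartzMap Set Complex

/-! ### The `L²` Fourier transform against the Fourier integral -/

section L2Fourier

variable {V : Type*} [NormedAddCommGroup V] [InnerProductSpace ℝ V] [FiniteDimensional ℝ V]
  [MeasurableSpace V] [BorelSpace V]

/-- The `L²` transform agrees with the distributional one, whose definition is this multiplication
formula. All later identifications of `L²` transforms are made by testing with it. -/
theorem integral_schwartz_mul_fourier (f : Lp (α := V) ℂ 2) (g : 𝓢(V, ℂ)) :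
    ∫ x, g x * (𝓕 f : Lp (α := V) ℂ 2) x = ∫ x, 𝓕 (g : V → ℂ) x * f x := by
  have h := congrArg (fun T : TemperedDistribution V ℂ => T g)
    (Lp.fourier_toTemperedDistribution_eq f)
  simp only [TemperedDistribution.fourier_apply, Lp.toTemperedDistribution_apply,
    smul_eq_mul] at h
  rw [← h, SchwartzMap.fourier_coe]

/-- On `L¹ ∩ L²` the `L²` Fourier transform is given by the Fourier integral. -/
theorem fourier_toLp_ae_eq {f : V → ℂ} (h1 : Integrable f) (h2 : MemLp f 2) :
    (𝓕 (h2.toLp f) : Lp (α := V) ℂ 2) =ᵐ[volume] 𝓕 f := by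
  have hc : Continuous (𝓕 f) := by
    exact VectorFourier.fourierIntegral_continuous Real.continuous_fourierChar
      (by simpa using continuous_inner) h1
  refine ae_eq_of_integral_contDiff_smul_eq
    ((Lp.memLp _).locallyIntegrable (by norm_num)) hc.locallyIntegrable fun u hu hs => ?_
  let g : 𝓢(V, ℂ) := HasCompactSupport.toSchwartzMap (f := fun x => (u x : ℂ))
    (hs.comp_left (g := fun r : ℝ => (r : ℂ)) (by simp)) (Complex.ofRealCLM.contDiff.comp hu)
  have hg : ∀ x, g x = (u x : ℂ) := fun x => rfl
  have h := integral_schwartz_mul_fourier (h2.toLp f) g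
  simp only [hg] at h
  simp only [Complex.real_smul]
  rw [h]
  have h3 : ∫ x, 𝓕 (g : V → ℂ) x * f x = ∫ x, g x * 𝓕 f x := by
    have := VectorFourier.integral_fourierIntegral_smul_eq_flip (μ := volume) (ν := volume)
      (L := innerₗ V) (f := (g : V → ℂ)) (g := f) Real.continuous_fourierChar
      (by simpa using continuous_inner) g.integrable h1
    simp only [flip_innerₗ, smul_eq_mul] at this
    exact this
  rw [← integral_congr_ae (h2.coeFn_toLp.mono fun x hx => by
    show 𝓕 (g : V → ℂ) x * f x = _
    rw [hx]), h3]
  simp only [hg]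

theorem integral_schwartz_mul_fourierInv (f : Lp (α := V) ℂ 2) (g : 𝓢(V, ℂ)) :
    ∫ x, g x * (𝓕⁻ f : Lp (α := V) ℂ 2) x = ∫ x, 𝓕⁻ (g : V → ℂ) x * f x := by
  have h := congrArg (fun T : TemperedDistribution V ℂ => T g)
    (Lp.fourierInv_toTemperedDistribution_eq f)
  simp only [TemperedDistribution.fourierInv_apply, Lp.toTemperedDistribution_apply,
    smul_eq_mul] at h
  rw [← h, SchwartzMap.fourierInv_coe]

theorem fourierInv_toLp_ae_eq {f : V → ℂ} (h1 : Integrable f) (h2 : MemLp f 2) :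
    (𝓕⁻ (h2.toLp f) : Lp (α := V) ℂ 2) =ᵐ[volume] 𝓕⁻ f := by
  have hL : Continuous fun p : V × V => (-innerₗ V) p.1 p.2 := by
    have : Continuous fun p : V × V => -inner ℝ p.1 p.2 := by fun_prop
    simpa using this
  have hc : Continuous (𝓕⁻ f) := by
    exact VectorFourier.fourierIntegral_continuous Real.continuous_fourierChar hL h1
  refine ae_eq_of_integral_contDiff_smul_eq
    ((Lp.memLp _).locallyIntegrable (by norm_num)) hc.locallyIntegrable fun u hu hs => ?_
  let g : 𝓢(V, ℂ) := HasCompactSupport.toSchwartzMap (f := fun x => (u x : ℂ))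
    (hs.comp_left (g := fun r : ℝ => (r : ℂ)) (by simp)) (Complex.ofRealCLM.contDiff.comp hu)
  have hg : ∀ x, g x = (u x : ℂ) := fun x => rfl
  have h := integral_schwartz_mul_fourierInv (h2.toLp f) g
  simp only [hg] at h
  simp only [Complex.real_smul]
  rw [h]
  have h3 : ∫ x, 𝓕⁻ (g : V → ℂ) x * f x = ∫ x, g x * 𝓕⁻ f x := by
    have := VectorFourier.integral_fourierIntegral_smul_eq_flip (μ := volume) (ν := volume)
      (L := -innerₗ V) (f := (g : V → ℂ)) (g := f) Real.continuous_fourierChar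
      hL g.integrable h1
    have hf : (-innerₗ V).flip = -innerₗ V := by
      ext x y; simp [real_inner_comm]
    simp only [hf, smul_eq_mul] at this
    exact this
  rw [← integral_congr_ae (h2.coeFn_toLp.mono fun x hx => by
    show 𝓕⁻ (g : V → ℂ) x * f x = _
    rw [hx]), h3]
  simp only [hg]

theorem lintegral_enorm_sq_fourier_Lp (f : Lp (α := V) ℂ 2) :
    ∫⁻ x, ‖(𝓕 f : Lp (α := V) ℂ 2) x‖ₑ ^ 2 = ∫⁻ x, ‖f x‖ₑ ^ 2 := by
  have key : ∀ g : Lp (α := V) ℂ 2, ∫⁻ x, ‖g x‖ₑ ^ 2 = ‖g‖ₑ ^ 2 := fun g => by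
    rw [Lp.enorm_def, eLpNorm_eq_lintegral_rpow_enorm_toReal (by norm_num) (by norm_num)]
    simp only [ENNReal.toReal_ofNat, ENNReal.rpow_ofNat, one_div]
    rw [← ENNReal.rpow_natCast, ← ENNReal.rpow_mul]
    norm_num
  rw [key, key, ← ofReal_norm, ← ofReal_norm, Lp.norm_fourier_eq]

/-- If the `L²` Fourier transform `k` of `f` is integrable, then `f` is the inverse Fourier
integral of `k`. -/
theorem ae_eq_fourierInv_of_fourier_ae_eq {f k : V → ℂ} (hf : MemLp f 2)
    (h1 : Integrable k) (h2 : MemLp k 2)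
    (h : (𝓕 (hf.toLp f) : Lp (α := V) ℂ 2) =ᵐ[volume] k) : f =ᵐ[volume] 𝓕⁻ k := by
  have hk : h2.toLp k = 𝓕 (hf.toLp f) :=
    Lp.ext (h2.coeFn_toLp.trans h.symm)
  have h3 := fourierInv_toLp_ae_eq h1 h2
  rw [hk, FourierTransform.fourierInv_fourier_eq] at h3
  exact hf.coeFn_toLp.symm.trans h3

end L2Fourier

/-! ### Contour shift without decay at infinity -/

/-- Cauchy's theorem on the unit square based at `x`, integrated over all `x`. The two vertical
sides are translates of each other by `v` and cancel, while the horizontal sides average back to the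
full integrals. Integrability on the slab thus replaces any pointwise decay. -/
theorem integral_eq_of_holomorphic_strip {V : Type*} [NormedAddCommGroup V] [NormedSpace ℝ V]
    [MeasurableSpace V] [BorelSpace V] [SecondCountableTopology V] (μ : Measure V)
    [SFinite μ] [μ.IsAddRightInvariant] (v : V) (H : V → ℝ → ℂ)
    (hol : ∀ x, DifferentiableOn ℂ (fun w : ℂ => H (x + w.re • v) w.im) {w | w.im ∈ Icc 0 1})
    (h0 : Integrable (fun x => H x 0) μ) (h1 : Integrable (fun x => H x 1) μ)
    (c0 : Continuous fun x => H x 0) (c1 : Continuous fun x => H x 1)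
    (hI : Integrable (Function.uncurry H) (μ.prod (volume.restrict (Ioc 0 1)))) :
    ∫ x, H x 0 ∂μ = ∫ x, H x 1 ∂μ := by
  have hrect : ∀ x, (∫ σ in (0:ℝ)..1, H (x + σ • v) 0) - (∫ σ in (0:ℝ)..1, H (x + σ • v) 1) +
      I * (∫ s in (0:ℝ)..1, H (x + v) s) - I * (∫ s in (0:ℝ)..1, H x s) = 0 := fun x => by
    have := integral_boundary_rect_eq_zero_of_differentiableOn
      (fun w : ℂ => H (x + w.re • v) w.im) 0 (1 + I) ((hol x).mono fun w hw => by
        have := hw.2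
        simpa [uIcc_of_le] using this)
    simpa using this
  have horiz : ∀ r : ℝ, Integrable (fun x => H x r) μ → Continuous (fun x => H x r) →
      Integrable (fun x => ∫ σ in (0:ℝ)..1, H (x + σ • v) r) μ ∧
      ∫ x, (∫ σ in (0:ℝ)..1, H (x + σ • v) r) ∂μ = ∫ x, H x r ∂μ := fun r hr cr => by
    have hint : Integrable (fun p : V × ℝ => H (p.1 + p.2 • v) r)
        (μ.prod (volume.restrict (Ioc 0 1))) := by
      have hmeas : AEStronglyMeasurable (fun p : V × ℝ => H (p.1 + p.2 • v) r)
          (μ.prod (volume.restrict (Ioc 0 1))) :=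
        (cr.comp (f := fun p : V × ℝ => p.1 + p.2 • v) (by fun_prop)).aestronglyMeasurable
      rw [integrable_prod_iff' hmeas]
      refine ⟨ae_of_all _ fun σ => hr.comp_add_right (σ • v), ?_⟩
      have : (fun σ : ℝ => ∫ x, ‖H (x + σ • v) r‖ ∂μ) = fun _ => ∫ x, ‖H x r‖ ∂μ := by
        ext σ; exact integral_add_right_eq_self (fun x => ‖H x r‖) (σ • v)
      simp only [this]
      exact integrable_const _
    simp only [intervalIntegral.integral_of_le zero_le_one]
    refine ⟨hint.integral_prod_left, ?_⟩
    rw [integral_integral_swap (f := fun x σ => H (x + σ • v) r) hint]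
    have : (fun σ : ℝ => ∫ x, H (x + σ • v) r ∂μ) = fun _ => ∫ x, H x r ∂μ := by
      ext σ; exact integral_add_right_eq_self (fun x => H x r) (σ • v)
    simp [this]
  obtain ⟨i0, e0⟩ := horiz 0 h0 c0
  obtain ⟨i1, e1⟩ := horiz 1 h1 c1
  have iq : Integrable (fun x => ∫ s in (0:ℝ)..1, H x s) μ := by
    simp only [intervalIntegral.integral_of_le zero_le_one]
    exact hI.integral_prod_left
  have iqv := iq.comp_add_right v
  have eqv := integral_add_right_eq_self (μ := μ) (fun x => ∫ s in (0:ℝ)..1, H x s) v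
  have htot : ∫ x, ((∫ σ in (0:ℝ)..1, H (x + σ • v) 0) - (∫ σ in (0:ℝ)..1, H (x + σ • v) 1) +
      I * (∫ s in (0:ℝ)..1, H (x + v) s) - I * (∫ s in (0:ℝ)..1, H x s)) ∂μ = 0 := by
    simp only [hrect, integral_zero]
  rw [integral_sub (by exact (i0.sub i1).add (iqv.const_mul I)) (iq.const_mul I),
    integral_add (by exact i0.sub i1) (iqv.const_mul I), integral_sub i0 i1, e0, e1,
    integral_const_mul, integral_const_mul, eqv] at htot
  linear_combination htot

theorem eLpNorm_two_sq {α : Type*} {m : MeasurableSpace α} {μ : Measure α} (f : α → ℂ) :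
    eLpNorm f 2 μ ^ 2 = ∫⁻ x, ‖f x‖ₑ ^ 2 ∂μ := by
  rw [eLpNorm_eq_lintegral_rpow_enorm_toReal (by norm_num) (by norm_num)]
  simp only [ENNReal.toReal_ofNat, ENNReal.rpow_ofNat, one_div]
  rw [← ENNReal.rpow_natCast, ← ENNReal.rpow_mul]
  norm_num

theorem memLp_two_iff {α : Type*} {m : MeasurableSpace α} {μ : Measure α} {f : α → ℂ} :
    MemLp f 2 μ ↔ AEStronglyMeasurable f μ ∧ ∫⁻ x, ‖f x‖ₑ ^ 2 ∂μ < ∞ := by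
  rw [MemLp, ← eLpNorm_two_sq, ENNReal.pow_lt_top_iff]
  simp

section Core

variable {V : Type*} [NormedAddCommGroup V] [InnerProductSpace ℝ V] [FiniteDimensional ℝ V]
  [MeasurableSpace V] [BorelSpace V]

theorem lintegral_enorm_sq_fourier {f : V → ℂ} (h1 : Integrable f) (h2 : MemLp f 2) :
    ∫⁻ x, ‖𝓕 f x‖ₑ ^ 2 = ∫⁻ x, ‖f x‖ₑ ^ 2 := by
  have e2 := lintegral_enorm_sq_fourier_Lp (h2.toLp f)
  have e3 : ∫⁻ x, ‖(𝓕 (h2.toLp f) : Lp (α := V) ℂ 2 volume) x‖ₑ ^ 2 = ∫⁻ x, ‖𝓕 f x‖ₑ ^ 2 :=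
    lintegral_congr_ae ((fourier_toLp_ae_eq h1 h2).mono fun x hx => by simp only [hx])
  have e4 : ∫⁻ x, ‖h2.toLp f x‖ₑ ^ 2 = ∫⁻ x, ‖f x‖ₑ ^ 2 :=
    lintegral_congr_ae (h2.coeFn_toLp.mono fun x hx => by simp only [hx])
  rw [← e3, e2, e4]

theorem lintegral_enorm_sq_fourierInv {f : V → ℂ} (h1 : Integrable f) (h2 : MemLp f 2) :
    ∫⁻ x, ‖𝓕⁻ f x‖ₑ ^ 2 = ∫⁻ x, ‖f x‖ₑ ^ 2 := by
  rw [← lintegral_enorm_sq_fourier h1 h2, ← lintegral_neg_eq_self (μ := volume) fun x => ‖𝓕 f x‖ₑ ^ 2]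
  simp only [Real.fourierInv_eq_fourier_neg]

/-- The Fourier–Laplace transform of `u` along the complex line `x + w v`. -/
noncomputable def lineFourier (v : V) (u : V → ℝ) (x : V) (w : ℂ) : ℂ :=
  ∫ t, cexp (-2 * Real.pi * I * (inner ℝ x t + w * inner ℝ v t)) * u t

/-- Each slice at imaginary parameter is the Fourier transform of a compactly supported function, so
it inherits Plancherel. -/
theorem lineFourier_eq_fourier (v : V) (u : V → ℝ) (x : V) (s : ℝ) :
    lineFourier v u x (s * I) =
      𝓕 (fun t => ((u t * Real.exp (2 * Real.pi * s * inner ℝ v t) : ℝ) : ℂ)) x := by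
  rw [lineFourier, Real.fourier_eq']
  congr 1; ext t
  rw [smul_eq_mul]
  push_cast
  rw [mul_comm (u t : ℂ), ← mul_assoc, ← Complex.exp_add, real_inner_comm t x]
  congr 2
  linear_combination (-2 * (Real.pi : ℂ) * s * (inner ℝ v t : ℝ)) * I_mul_I

theorem lineFourier_add (v : V) (u : V → ℝ) (x : V) (w : ℂ) :
    lineFourier v u (x + w.re • v) (w.im * I) = lineFourier v u x w := by
  rw [lineFourier, lineFourier]
  congr 1; ext t
  congr 2
  rw [inner_add_left, real_inner_smul_left]
  push_cast
  nth_rewrite 3 [← re_add_im w]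
  ring

theorem differentiable_lineFourier (v : V) {u : V → ℝ} (hu : Continuous u)
    (hs : HasCompactSupport u) (x : V) : Differentiable ℂ (lineFourier v u x) := by
  intro w₀
  let F : ℂ → V → ℂ := fun w t =>
    cexp (-2 * Real.pi * I * (inner ℝ x t + w * inner ℝ v t)) * u t
  let F' : ℂ → V → ℂ := fun w t =>
    cexp (-2 * Real.pi * I * (inner ℝ x t + w * inner ℝ v t)) *
      (-2 * Real.pi * I * inner ℝ v t) * u t
  have hsu : HasCompactSupport fun t => (u t : ℂ) :=
    hs.comp_left (g := fun r : ℝ => (r : ℂ)) (by simp)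
  have hc : Continuous (Function.uncurry F') := by
    simp only [F', Function.uncurry_def]; fun_prop
  obtain ⟨C, hC⟩ := ((isCompact_closedBall w₀ 1).prod hs).exists_bound_of_continuousOn
    hc.continuousOn
  have hz : ∀ t, t ∉ tsupport u → u t = 0 := fun t ht => image_eq_zero_of_notMem_tsupport ht
  refine (hasDerivAt_integral_of_dominated_loc_of_deriv_le (μ := volume) (F := F) (F' := F')
    (bound := (tsupport u).indicator fun _ => C) (Metric.closedBall_mem_nhds w₀ one_pos)
    (Filter.Eventually.of_forall fun w => ?_) ?_ ?_ ?_ ?_ ?_).2.differentiableAt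
  · exact (by simp only [F]; fun_prop : Continuous (F w)).aestronglyMeasurable
  · refine (by simp only [F]; fun_prop : Continuous (F w₀)).integrable_of_hasCompactSupport ?_
    exact hsu.mul_left
  · exact (by simp only [F']; fun_prop : Continuous (F' w₀)).aestronglyMeasurable
  · refine ae_of_all _ fun t w hw => ?_
    by_cases ht : t ∈ tsupport u
    · rw [indicator_of_mem ht]
      exact hC (w, t) ⟨hw, ht⟩
    · simp [F', hz t ht, ht]
  · rw [integrable_indicator_iff (isClosed_tsupport u).measurableSet]
    exact integrableOn_const hs.measure_lt_top.ne
  · refine ae_of_all _ fun t w _ => ?_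
    have h1 : HasDerivAt (fun w : ℂ => -2 * Real.pi * I * (inner ℝ x t + w * inner ℝ v t))
        (-2 * Real.pi * I * inner ℝ v t) w := by
      simpa using (((hasDerivAt_id w).mul_const ((inner ℝ v t : ℝ) : ℂ)).const_add
        ((inner ℝ x t : ℝ) : ℂ)).const_mul (-2 * Real.pi * I)
    exact h1.cexp.mul_const _

/-- The `L²` Fourier transforms of two parallel slices of a holomorphic function on a tube differ by
an exponential factor. -/
theorem fourier_slice_eq (v : V) (Φ : V → ℝ → ℂ)
    (hol : ∀ x, DifferentiableOn ℂ (fun w : ℂ => Φ (x + w.re • v) w.im) {w | w.im ∈ Icc 0 1})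
    (hm : AEStronglyMeasurable (Function.uncurry Φ) (volume.prod (volume.restrict (Ioc 0 1))))
    (c0 : Continuous fun x => Φ x 0) (c1 : Continuous fun x => Φ x 1)
    (h0 : MemLp (fun x => Φ x 0) 2) (h1 : MemLp (fun x => Φ x 1) 2)
    (hI : ∫⁻ s in Ioc (0:ℝ) 1, ∫⁻ x, ‖Φ x s‖ₑ ^ 2 < ∞) :
    (𝓕 (h0.toLp _) : Lp (α := V) ℂ 2) =ᵐ[volume] fun t =>
      (Real.exp (2 * Real.pi * inner ℝ v t) : ℂ) * (𝓕 (h1.toLp _) : Lp (α := V) ℂ 2) t := by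
  have hloc : ∀ f : Lp (α := V) ℂ 2, LocallyIntegrable f volume := fun f =>
    (Lp.memLp f).locallyIntegrable (by norm_num)
  refine ae_eq_of_integral_contDiff_smul_eq (hloc _) ?_ fun u hu hs => ?_
  · exact (hloc _).continuous_mul (by fun_prop)
  -- The transforms of `k s` continue `𝓕 u` holomorphically along `v`. At `s = 0` the function is
  -- `u`; at `s = 1` it carries the exponential factor of the conclusion.
  let k : ℝ → V → ℝ := fun s t => u t * Real.exp (2 * Real.pi * s * inner ℝ v t)
  have kc : ∀ s, Continuous (k s) := fun s => by
    have := hu.continuous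
    simp only [k]; fun_prop
  have ks : ∀ s, HasCompactSupport (k s) := fun s => hs.mul_right
  have ksm : ∀ s, ContDiff ℝ (⊤ : ℕ∞) (k s) := fun s => by
    have h : ContDiff ℝ (⊤ : ℕ∞) fun t : V => inner ℝ v t := contDiff_const.inner ℝ contDiff_id
    exact hu.mul (Real.contDiff_exp.comp (contDiff_const.mul h))
  have ksC : ∀ s, HasCompactSupport fun t => (k s t : ℂ) := fun s =>
    (ks s).comp_left (g := fun r : ℝ => (r : ℂ)) (by simp)
  have kcC : ∀ s, Continuous fun t => (k s t : ℂ) := fun s => Complex.continuous_ofReal.comp (kc s)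
  let g : ℝ → 𝓢(V, ℂ) := fun s => HasCompactSupport.toSchwartzMap (f := fun t => (k s t : ℂ))
    (ksC s) (Complex.ofRealCLM.contDiff.comp (ksm s))
  have hg : ∀ s t, g s t = (k s t : ℂ) := fun s t => rfl
  let χ : V → ℝ → ℂ := fun x s => lineFourier v u x (s * I)
  have hχ : ∀ s, (fun x => χ x s) = 𝓕 (g s : V → ℂ) := fun s => by
    ext x; exact lineFourier_eq_fourier v u x s
  have kL2 : ∀ s, MemLp (fun t => (k s t : ℂ)) 2 := fun s =>
    (kcC s).memLp_of_hasCompactSupport (ksC s)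
  have kL1 : ∀ s, Integrable (fun t => (k s t : ℂ)) := fun s =>
    (kcC s).integrable_of_hasCompactSupport (ksC s)
  have χnorm : ∀ s, ∫⁻ x, ‖χ x s‖ₑ ^ 2 = ∫⁻ t, ‖(k s t : ℂ)‖ₑ ^ 2 := fun s => by
    rw [← lintegral_enorm_sq_fourier (kL1 s) (kL2 s)]
    refine lintegral_congr fun x => ?_
    rw [congrFun (hχ s) x]; rfl
  have χL2 : ∀ s, MemLp (fun x => χ x s) 2 := fun s => by
    refine memLp_two_iff.2 ⟨?_, ?_⟩
    · rw [hχ, ← SchwartzMap.fourier_coe]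
      exact (𝓕 (g s)).continuous.aestronglyMeasurable
    · rw [χnorm]; exact (memLp_two_iff.1 (kL2 s)).2
  have χc : ∀ s, Continuous (fun x => χ x s) := fun s => by
    rw [hχ, ← SchwartzMap.fourier_coe]; exact (𝓕 (g s)).continuous
  have χm : StronglyMeasurable (Function.uncurry χ) := by
    have : StronglyMeasurable (Function.uncurry fun (p : V × ℝ) (t : V) =>
        cexp (-2 * Real.pi * I * (inner ℝ p.1 t + p.2 * I * inner ℝ v t)) * u t) := by
      have := hu.continuous
      refine Continuous.stronglyMeasurable ?_
      simp only [Function.uncurry_def]; fun_prop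
    exact this.integral_prod_right
  have χP : MemLp (Function.uncurry χ) 2 (volume.prod (volume.restrict (Ioc 0 1))) := by
    refine memLp_two_iff.2 ⟨χm.aestronglyMeasurable, ?_⟩
    rw [lintegral_prod_symm _ (by
      exact (χm.measurable.enorm.pow_const 2).aemeasurable)]
    -- A majorant of `k s` uniform in `0 < s ≤ 1`, so that `χ` is square integrable on the slab.
    let b : V → ℝ := fun t => u t * Real.exp (2 * Real.pi * |inner ℝ v t|)
    have bc : Continuous fun t => (b t : ℂ) := by
      have := hu.continuous
      simp only [b]; fun_prop
    have bs : HasCompactSupport fun t => (b t : ℂ) := by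
      have : HasCompactSupport b := hs.mul_right
      exact this.comp_left (g := fun r : ℝ => (r : ℂ)) (by simp)
    have hb := (memLp_two_iff.1 (bc.memLp_of_hasCompactSupport (μ := volume) (p := 2) bs)).2
    calc ∫⁻ s in Ioc (0:ℝ) 1, ∫⁻ x, ‖χ x s‖ₑ ^ 2
        ≤ ∫⁻ s in Ioc (0:ℝ) 1, ∫⁻ t, ‖(b t : ℂ)‖ₑ ^ 2 := by
          refine setLIntegral_mono measurable_const fun s hs' => ?_
          rw [χnorm]
          gcongr with t
          rw [← ofReal_norm, ← ofReal_norm]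
          apply ENNReal.ofReal_le_ofReal
          simp only [k, b, norm_real, norm_mul, Real.norm_eq_abs, Real.abs_exp]
          have h1 : s * inner ℝ v t ≤ |inner ℝ v t| := by
            refine (le_abs_self _).trans ?_
            rw [abs_mul, abs_of_pos hs'.1]
            exact mul_le_of_le_one_left (abs_nonneg _) hs'.2
          have h2 : 2 * Real.pi * s * inner ℝ v t ≤ 2 * Real.pi * |inner ℝ v t| := by
            rw [mul_assoc]
            exact mul_le_mul_of_nonneg_left h1 Real.two_pi_pos.le
          exact mul_le_mul_of_nonneg_left (Real.exp_le_exp.2 h2) (abs_nonneg _)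
      _ < ∞ := by simpa using hb
  have ΦP : MemLp (Function.uncurry Φ) 2 (volume.prod (volume.restrict (Ioc 0 1))) := by
    refine memLp_two_iff.2 ⟨hm, ?_⟩
    rw [lintegral_prod_symm _ (hm.enorm.pow_const 2)]
    exact hI
  -- The product of two `L²` functions on the slab is integrable, which is what the contour shift
  -- needs.
  have key := integral_eq_of_holomorphic_strip volume v (fun x s => Φ x s * χ x s)
    (fun x => (hol x).mul (by
      simp only [χ, lineFourier_add]
      exact (differentiable_lineFourier v hu.continuous hs x).differentiableOn))
    (h0.integrable_mul (χL2 0)) (h1.integrable_mul (χL2 1)) (c0.mul (χc 0)) (c1.mul (χc 1))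
    (ΦP.integrable_mul χP)
  have pair : ∀ (s : ℝ) (hs : MemLp (fun x => Φ x s) 2), ∫ x, Φ x s * χ x s =
      ∫ t, (k s t : ℂ) * (𝓕 (hs.toLp _) : Lp (α := V) ℂ 2) t := fun s hs => by
    have := integral_schwartz_mul_fourier (hs.toLp _) (g s)
    simp only [hg] at this
    rw [this]
    refine integral_congr_ae (hs.coeFn_toLp.mono fun x hx => ?_)
    simp only
    rw [hx, ← hχ, mul_comm]
  rw [pair 0 h0, pair 1 h1] at key
  simp only [k, mul_zero, zero_mul, Real.exp_zero, mul_one] at key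
  simp only [Complex.real_smul]
  rw [key]
  congr 1; ext t
  push_cast; ring

end Core

/-! ### Coordinates and self-duality of the cone -/

/-- Coordinates on `ℝ³` in which the Lorentz cone is `‖p.2‖ < p.1`. -/
def vec (p : ℝ × ℂ) : Fin 3 → ℝ := ![p.1, p.2.re, p.2.im]

noncomputable def vecEquiv : ℝ × ℂ ≃ᵐ (Fin 3 → ℝ) :=
  ((MeasurableEquiv.refl ℝ).prodCongr Complex.measurableEquivPi).trans
    (MeasurableEquiv.piFinSuccAbove (fun _ : Fin 3 => ℝ) 0).symm

theorem vecEquiv_apply (p : ℝ × ℂ) : vecEquiv p = vec p := by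
  ext j
  fin_cases j <;>
    simp [vecEquiv, vec, MeasurableEquiv.piFinSuccAbove, Complex.measurableEquivPi_apply,
      MeasurableEquiv.prodCongr]

theorem measurePreserving_vecEquiv : MeasurePreserving vecEquiv :=
  (volume_preserving_piFinSuccAbove (fun _ : Fin 3 => ℝ) 0).symm.comp
    ((MeasurePreserving.id volume).prod Complex.volume_preserving_equiv_pi)

/-- The point `x + i y` of `ℂ³`. -/
def pt (x y : ℝ × ℂ) : Fin 3 → ℂ := fun j => (vec x j : ℂ) + I * (vec y j : ℂ)

def dot (y p : ℝ × ℂ) : ℝ := y.1 * p.1 + y.2.re * p.2.re + y.2.im * p.2.im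

def cone : Set (ℝ × ℂ) := {y | ‖y.2‖ < y.1}

def closedCone : Set (ℝ × ℂ) := {p | ‖p.2‖ ≤ p.1}

theorem vec_mem_lorentzCone {y : ℝ × ℂ} : vec y ∈ lorentzCone ↔ y ∈ cone := by
  have h : ‖y.2‖ ^ 2 = y.2.re ^ 2 + y.2.im ^ 2 := by
    rw [Complex.sq_norm, Complex.normSq_apply]; ring
  simp only [lorentzCone, lorentzForm, vec, cone, mem_ofPred_eq, Matrix.cons_val_zero,
    Matrix.cons_val_one, Matrix.cons_val]
  have h0 := norm_nonneg y.2
  constructor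
  · rintro ⟨h1, h2⟩; exact lt_of_pow_lt_pow_left₀ 2 h2.le (by linarith)
  · intro h1; exact ⟨by nlinarith, by linarith⟩

theorem exists_vec_eq (y : Fin 3 → ℝ) : ∃ p, vec p = y :=
  ⟨vecEquiv.symm y, by rw [← vecEquiv_apply, MeasurableEquiv.apply_symm_apply]⟩

theorem hardyENorm_sq (F : (Fin 3 → ℂ) → ℂ) :
    hardyENorm lorentzCone F ^ 2 = ⨆ y ∈ cone, ∫⁻ x, ‖F (pt x y)‖ₑ ^ 2 := by
  rw [hardyENorm, ← ENNReal.rpow_natCast, ← ENNReal.rpow_mul]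
  have hint : ∀ y : ℝ × ℂ,
      ∫⁻ x : Fin 3 → ℝ, ‖F (fun j => (x j : ℂ) + I * (vec y j : ℂ))‖ₑ ^ 2 =
        ∫⁻ x, ‖F (pt x y)‖ₑ ^ 2 := fun y => by
    rw [← measurePreserving_vecEquiv.lintegral_comp_emb vecEquiv.measurableEmbedding]
    simp only [vecEquiv_apply]
    rfl
  norm_num
  refine le_antisymm (iSup₂_le fun y hy => ?_) (iSup₂_le fun y hy => ?_)
  · obtain ⟨p, rfl⟩ := exists_vec_eq y
    rw [hint]
    exact le_iSup₂ (f := fun y (_ : y ∈ cone) => ∫⁻ x, ‖F (pt x y)‖ₑ ^ 2) p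
      (vec_mem_lorentzCone.1 hy)
  · rw [← hint]
    exact le_iSup₂ (f := fun y (_ : y ∈ lorentzCone) =>
      ∫⁻ x : Fin 3 → ℝ, ‖F (fun j => (x j : ℂ) + I * (y j : ℂ))‖ₑ ^ 2) (vec y)
      (vec_mem_lorentzCone.2 hy)

theorem pt_mem_tubeDomain {x y : ℝ × ℂ} : pt x y ∈ tubeDomain lorentzCone ↔ y ∈ cone := by
  rw [← vec_mem_lorentzCone]
  simp [tubeDomain, pt]

theorem exists_pt_eq (z : Fin 3 → ℂ) : ∃ x y, pt x y = z := by
  obtain ⟨x, hx⟩ := exists_vec_eq fun j => (z j).re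
  obtain ⟨y, hy⟩ := exists_vec_eq fun j => (z j).im
  refine ⟨x, y, ?_⟩
  ext j
  rw [pt, hx, hy, mul_comm, re_add_im]

theorem isOpen_tubeDomain : IsOpen (tubeDomain lorentzCone) := by
  have h : IsOpen lorentzCone := by
    simp only [lorentzCone, lorentzForm, ofPred_and]
    exact (isOpen_lt (by fun_prop) (by fun_prop)).inter (isOpen_lt (by fun_prop) (by fun_prop))
  exact h.preimage (by fun_prop)

theorem isClosed_closedCone : IsClosed closedCone := isClosed_le (by fun_prop) (by fun_prop)

theorem isOpen_cone : IsOpen cone := isOpen_lt (by fun_prop) (by fun_prop)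

theorem abs_dot_sub_le (y p : ℝ × ℂ) : |dot y p - y.1 * p.1| ≤ ‖y.2‖ * ‖p.2‖ := by
  have : dot y p - y.1 * p.1 = ((starRingEnd ℂ) y.2 * p.2).re := by
    simp [dot]; ring
  rw [this]
  exact (abs_re_le_norm _).trans (by simp)

/-- A quantitative half of self-duality: for `y` in the cone, the gap `y.1 - ‖y.2‖` is the rate at
which the kernel decays in `p.1`. -/
theorem le_dot {p : ℝ × ℂ} (hp : p ∈ closedCone) (y : ℝ × ℂ) :
    (y.1 - ‖y.2‖) * p.1 ≤ dot y p := by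
  have h1 := (abs_le.1 (abs_dot_sub_le y p)).1
  have h2 : ‖y.2‖ * ‖p.2‖ ≤ ‖y.2‖ * p.1 := mul_le_mul_of_nonneg_left hp (norm_nonneg _)
  linarith

/-- The other half of self-duality; it locates the support in the Paley–Wiener theorem. -/
theorem exists_dot_neg {p : ℝ × ℂ} (hp : p ∉ closedCone) : ∃ y ∈ cone, dot y p < 0 := by
  have hp' : p.1 < ‖p.2‖ := not_le.1 hp
  by_cases h0 : p.1 < 0
  · exact ⟨(1, 0), by simp [cone], by simp [dot, h0]⟩
  · push Not at h0
    have hn : 0 < ‖p.2‖ := h0.trans_lt hp'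
    have hsq : ‖p.2‖ ^ 2 = p.2.re ^ 2 + p.2.im ^ 2 := by
      rw [Complex.sq_norm, Complex.normSq_apply]; ring
    -- With this choice the pairing equals `(‖p.2‖ - p.1) * (p.1 / 2 - ‖p.2‖)`, which is negative.
    refine ⟨(‖p.2‖ + (‖p.2‖ - p.1) / 2, -p.2), ?_, ?_⟩
    · simp only [cone, mem_ofPred_eq, norm_neg]; linarith
    · simp only [dot, neg_re, neg_im]; nlinarith

theorem abs_vec_le {p : ℝ × ℂ} (hp : p ∈ closedCone) (j : Fin 3) : |vec p j| ≤ p.1 := by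
  have h0 : 0 ≤ p.1 := (norm_nonneg _).trans hp
  fin_cases j
  · simp [vec, abs_of_nonneg h0]
  · exact (abs_re_le_norm _).trans hp
  · exact (abs_im_le_norm _).trans hp

/-! ### Laplace transforms on the cone and the action of `□` -/

/-- The exponential kernel `e^{2πi z·p}`. -/
noncomputable def kern (z : Fin 3 → ℂ) (p : ℝ × ℂ) : ℂ :=
  cexp (2 * Real.pi * I * (z 0 * p.1 + z 1 * p.2.re + z 2 * p.2.im))

/-- The Fourier–Laplace transform of a function on (the dual of) `ℝ³`. -/
noncomputable def laplace (f : ℝ × ℂ → ℂ) (z : Fin 3 → ℂ) : ℂ := ∫ p, kern z p * f p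

theorem kern_pt (x y p : ℝ × ℂ) :
    kern (pt x y) p = cexp (2 * Real.pi * dot x p * I) * Real.exp (-2 * Real.pi * dot y p) := by
  rw [kern, ofReal_exp, ← Complex.exp_add]
  congr 1
  simp only [pt, vec, dot, Matrix.cons_val_zero, Matrix.cons_val_one, Matrix.cons_val]
  push_cast
  linear_combination 2 * (Real.pi : ℂ) * (y.1 * p.1 + y.2.re * p.2.re + y.2.im * p.2.im) * I_mul_I

theorem norm_kern_pt (x y p : ℝ × ℂ) :
    ‖kern (pt x y) p‖ = Real.exp (-2 * Real.pi * dot y p) := by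
  rw [kern_pt, norm_mul, norm_real, Real.norm_eq_abs, Real.abs_exp,
    show (2 * Real.pi * dot x p * I : ℂ) = ((2 * Real.pi * dot x p : ℝ) : ℂ) * I by push_cast; rfl,
    norm_exp_ofReal_mul_I, one_mul]

theorem continuous_kern : Continuous (Function.uncurry kern) := by
  simp only [kern, Function.uncurry_def]; fun_prop

/-- Functions carried by the closed cone whose Laplace transform converges on the whole tube. -/
structure Adm (f : ℝ × ℂ → ℂ) : Prop where
  meas : AEStronglyMeasurable f
  supp : ∀ p, p ∉ closedCone → f p = 0
  integrable : ∀ c : ℝ, 0 < c → Integrable fun p => Real.exp (-c * p.1) * ‖f p‖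

/-- Half of the exponential absorbs the linear growth of `h`. Since `Adm` asks for every rate `c >
0`, the loss is harmless and the step can be repeated for each derivative. -/
theorem Adm.mul {f : ℝ × ℂ → ℂ} (hf : Adm f) {h : ℝ × ℂ → ℂ} (hh : Continuous h)
    {C : ℝ} (hC : ∀ p ∈ closedCone, ‖h p‖ ≤ C * p.1) : Adm fun p => h p * f p where
  meas := hh.aestronglyMeasurable.mul hf.meas
  supp p hp := by rw [hf.supp p hp, mul_zero]
  integrable c hc := by
    refine ((hf.integrable (c / 2) (half_pos hc)).const_mul (|C| * (2 / c))).mono' ?_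
      (ae_of_all _ fun p => ?_)
    · have := (hh.aestronglyMeasurable.mul hf.meas).norm (μ := volume)
      exact (by fun_prop : Continuous fun p : ℝ × ℂ =>
        Real.exp (-c * p.1)).aestronglyMeasurable.mul this
    · by_cases hp : p ∈ closedCone
      · have h0 : 0 ≤ p.1 := (norm_nonneg _).trans hp
        have h1 : p.1 ≤ 2 / c * Real.exp (c / 2 * p.1) := by
          rw [div_mul_eq_mul_div, le_div_iff₀ hc]
          nlinarith [Real.add_one_le_exp (c / 2 * p.1)]
        have h2 : ‖h p‖ ≤ |C| * (2 / c) * Real.exp (c / 2 * p.1) := by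
          refine (hC p hp).trans ?_
          rw [mul_assoc]
          exact (mul_le_mul_of_nonneg_right (le_abs_self C) h0).trans
            (mul_le_mul_of_nonneg_left h1 (abs_nonneg C))
        have h3 : Real.exp (-c * p.1) * Real.exp (c / 2 * p.1) = Real.exp (-(c / 2) * p.1) := by
          rw [← Real.exp_add]; congr 1; ring
        rw [norm_mul, Real.norm_eq_abs, Real.abs_exp, norm_norm, norm_mul, ← h3]
        calc _ ≤ Real.exp (-c * p.1) * (|C| * (2 / c) * Real.exp (c / 2 * p.1) * ‖f p‖) := by
              gcongr
          _ = _ := by ring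
      · simp [hf.supp p hp]

theorem Adm.vec_mul {f : ℝ × ℂ → ℂ} (hf : Adm f) (j : Fin 3) :
    Adm fun p => (2 * Real.pi * vec p j : ℝ) * f p := by
  refine hf.mul (C := 2 * Real.pi) ?_ fun p hp => ?_
  · have : Continuous fun p => vec p j := by
      fin_cases j
      · exact continuous_fst
      · exact continuous_re.comp continuous_snd
      · exact continuous_im.comp continuous_snd
    fun_prop
  · rw [norm_real, Real.norm_eq_abs, abs_mul, abs_of_pos Real.two_pi_pos]
    exact mul_le_mul_of_nonneg_left (abs_vec_le hp j) Real.two_pi_pos.le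

theorem norm_kern_mul_le {f : ℝ × ℂ → ℂ} (hf : Adm f) (x : ℝ × ℂ) {y : ℝ × ℂ} {c : ℝ}
    (hc : c ≤ 2 * Real.pi * (y.1 - ‖y.2‖)) (p : ℝ × ℂ) :
    ‖kern (pt x y) p * f p‖ ≤ Real.exp (-c * p.1) * ‖f p‖ := by
  by_cases hp : p ∈ closedCone
  · rw [norm_mul, norm_kern_pt]
    have h0 : 0 ≤ p.1 := (norm_nonneg _).trans hp
    have := mul_le_mul_of_nonneg_right hc h0
    refine mul_le_mul_of_nonneg_right (Real.exp_le_exp.2 ?_) (norm_nonneg _)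
    have h2 := mul_le_mul_of_nonneg_left (le_dot hp y) Real.two_pi_pos.le
    linarith
  · simp [hf.supp p hp]

theorem Adm.integrable_kern {f : ℝ × ℂ → ℂ} (hf : Adm f) (x : ℝ × ℂ) {y : ℝ × ℂ}
    (hy : y ∈ cone) : Integrable fun p => kern (pt x y) p * f p := by
  refine (hf.integrable (2 * Real.pi * (y.1 - ‖y.2‖))
    (mul_pos Real.two_pi_pos (sub_pos.2 hy))).mono' ?_
      (ae_of_all _ fun p => norm_kern_mul_le hf x le_rfl p)
  exact (continuous_kern.comp (Continuous.prodMk_right (pt x y))).aestronglyMeasurable.mul hf.meas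

/-- The differential of `z ↦ 2πi z·p`. -/
noncomputable def kernForm (p : ℝ × ℂ) : (Fin 3 → ℂ) →L[ℂ] ℂ :=
  (2 * Real.pi * I) • ((p.1 : ℂ) • ContinuousLinearMap.proj 0 +
    (p.2.re : ℂ) • ContinuousLinearMap.proj 1 + (p.2.im : ℂ) • ContinuousLinearMap.proj 2)

theorem kernForm_apply (p : ℝ × ℂ) (z : Fin 3 → ℂ) :
    kernForm p z = 2 * Real.pi * I * (z 0 * p.1 + z 1 * p.2.re + z 2 * p.2.im) := by
  simp [kernForm]; ring

theorem norm_kernForm_le {p : ℝ × ℂ} (hp : p ∈ closedCone) :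
    ‖kernForm p‖ ≤ 6 * Real.pi * p.1 := by
  have h0 : 0 ≤ p.1 := (norm_nonneg _).trans hp
  refine ContinuousLinearMap.opNorm_le_bound _ (by positivity) fun z => ?_
  rw [kernForm_apply]
  have hj : ∀ j, ‖z j * (vec p j : ℂ)‖ ≤ ‖z‖ * p.1 := fun j => by
    rw [norm_mul, norm_real]
    exact mul_le_mul (norm_le_pi_norm z j) (abs_vec_le hp j) (norm_nonneg _) (norm_nonneg _)
  have := (norm_add₃_le (a := z 0 * (vec p 0 : ℂ)) (b := z 1 * (vec p 1 : ℂ))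
    (c := z 2 * (vec p 2 : ℂ))).trans (add_le_add_three (hj 0) (hj 1) (hj 2))
  simp only [vec, Matrix.cons_val_zero, Matrix.cons_val_one, Matrix.cons_val] at this
  rw [norm_mul]
  have h2 : ‖(2 * Real.pi * I : ℂ)‖ = 2 * Real.pi := by
    simp [abs_of_pos Real.pi_pos]
  rw [h2]
  nlinarith [Real.pi_pos]

theorem continuous_kernForm : Continuous kernForm := by
  unfold kernForm; fun_prop

theorem Adm.hasFDerivAt_laplace {f : ℝ × ℂ → ℂ} (hf : Adm f) {z : Fin 3 → ℂ}
    (hz : z ∈ tubeDomain lorentzCone) :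
    Integrable (fun p => (kern z p * f p) • kernForm p) ∧
    HasFDerivAt (laplace f) (∫ p, (kern z p * f p) • kernForm p) z := by
  obtain ⟨x, y, rfl⟩ := exists_pt_eq z
  rw [pt_mem_tubeDomain] at hz
  set δ := y.1 - ‖y.2‖ with hδ
  have hδ0 : 0 < δ := sub_pos.2 hz
  -- Within `δ / 6` in the sup norm, `y.1` drops by at most `δ / 6` and `‖y.2‖` grows by at most `δ
  -- / 3`, so the gap stays at least `δ / 2` and the decay rate at least `π δ`.
  have hbound : ∀ z' ∈ Metric.ball (pt x y) (δ / 6), ∀ p,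
      ‖kern z' p * f p‖ ≤ Real.exp (-(Real.pi * δ) * p.1) * ‖f p‖ := fun z' hz' p => by
    obtain ⟨x', y', rfl⟩ := exists_pt_eq z'
    have hj : ∀ j, |vec y' j - vec y j| ≤ δ / 6 := fun j => by
      have h1 := (norm_le_pi_norm (pt x' y' - pt x y) j).trans
        (mem_ball_iff_norm.1 hz').le
      refine le_trans ?_ ((abs_im_le_norm _).trans h1)
      simp [pt]
    have h0 := hj 0
    have h12 : ‖y'.2 - y.2‖ ≤ δ / 6 + δ / 6 :=
      (norm_le_abs_re_add_abs_im _).trans (add_le_add (hj 1) (hj 2))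
    have h3 : ‖y'.2‖ ≤ ‖y.2‖ + ‖y'.2 - y.2‖ := norm_le_norm_add_norm_sub' _ _
    have h0' := (abs_le.1 h0).1
    simp only [vec, Matrix.cons_val_zero] at h0'
    refine norm_kern_mul_le hf x' ?_ p
    have : δ / 2 ≤ y'.1 - ‖y'.2‖ := by linarith
    nlinarith [Real.pi_pos]
  have hmk : ∀ z', AEStronglyMeasurable fun p => kern z' p * f p := fun z' =>
    (continuous_kern.comp (Continuous.prodMk_right z')).aestronglyMeasurable.mul hf.meas
  have hF' : AEStronglyMeasurable fun p => (kern (pt x y) p * f p) • kernForm p :=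
    (hmk _).smul continuous_kernForm.aestronglyMeasurable
  have hadm := (hf.mul (h := fun p => ((6 * Real.pi * p.1 : ℝ) : ℂ)) (C := 6 * Real.pi)
    (by fun_prop) fun p hp => by
      have h0 : 0 ≤ p.1 := (norm_nonneg _).trans hp
      rw [norm_real, Real.norm_of_nonneg (by positivity)]).integrable (Real.pi * δ)
      (mul_pos Real.pi_pos hδ0)
  have hb' : ∀ p, ∀ z' ∈ Metric.ball (pt x y) (δ / 6), ‖(kern z' p * f p) • kernForm p‖ ≤
      Real.exp (-(Real.pi * δ) * p.1) * ‖((6 * Real.pi * p.1 : ℝ) : ℂ) * f p‖ := fun p z' hz' => by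
    by_cases hp : p ∈ closedCone
    · have h0 : 0 ≤ p.1 := (norm_nonneg _).trans hp
      rw [norm_smul, norm_mul ((_ : ℝ) : ℂ), norm_real, Real.norm_of_nonneg (by positivity)]
      calc _ ≤ Real.exp (-(Real.pi * δ) * p.1) * ‖f p‖ * (6 * Real.pi * p.1) :=
            mul_le_mul (hbound z' hz' p) (norm_kernForm_le hp) (norm_nonneg _) (by positivity)
        _ = _ := by ring
    · rw [norm_smul, hf.supp p hp, mul_zero, mul_zero, norm_zero, zero_mul, mul_zero]
  have hball : Metric.ball (pt x y) (δ / 6) ∈ nhds (pt x y) :=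
    Metric.ball_mem_nhds _ (by positivity)
  refine ⟨hadm.mono' hF' (ae_of_all _ fun p => hb' p _ (mem_of_mem_nhds hball)), ?_⟩
  refine hasFDerivAt_integral_of_dominated_of_fderiv_le (μ := volume)
    (F := fun z' p => kern z' p * f p) (F' := fun z' p => (kern z' p * f p) • kernForm p)
    hball (Filter.Eventually.of_forall hmk) (hf.integrable_kern x hz) hF'
    (ae_of_all _ hb') hadm (ae_of_all _ fun p z' _ => ?_)
  have h1 : HasFDerivAt (fun z' : Fin 3 → ℂ => kernForm p z') (kernForm p) z' :=
    (kernForm p).hasFDerivAt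
  have h2 : HasFDerivAt (fun z' => kern z' p) (kern z' p • kernForm p) z' := by
    have := h1.cexp
    simp only [kernForm_apply] at this
    exact this
  have h3 := h2.mul_const (f p)
  rw [smul_smul, mul_comm (f p)] at h3
  exact h3

theorem Adm.differentiableOn_laplace {f : ℝ × ℂ → ℂ} (hf : Adm f) :
    DifferentiableOn ℂ (laplace f) (tubeDomain lorentzCone) := fun _ hz =>
  (hf.hasFDerivAt_laplace hz).2.differentiableAt.differentiableWithinAt

/-- Differentiation brings down `2π p_j`. Agreement is only asked on the tube, which is open, so the
result can be iterated whatever the values off the tube. -/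
theorem Adm.momentum_laplace {f : ℝ × ℂ → ℂ} (hf : Adm f) {F : (Fin 3 → ℂ) → ℂ}
    (hF : EqOn F (laplace f) (tubeDomain lorentzCone)) (j : Fin 3) :
    EqOn (momentum j F) (laplace fun p => (2 * Real.pi * vec p j : ℝ) * f p)
      (tubeDomain lorentzCone) := fun z hz => by
  obtain ⟨hi, hd⟩ := hf.hasFDerivAt_laplace hz
  have hd' : HasFDerivAt F _ z :=
    hd.congr_of_eventuallyEq (hF.eventuallyEq_of_mem (isOpen_tubeDomain.mem_nhds hz))
  have hl := ((hd'.restrictScalars ℝ).hasLineDerivAt (Pi.single j 1)).lineDeriv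
  rw [momentum, hl, ContinuousLinearMap.coe_restrictScalars',
    ContinuousLinearMap.integral_apply hi, laplace, ← integral_const_mul]
  congr 1; ext p
  have : kernForm p (Pi.single j 1) = 2 * Real.pi * I * vec p j := by
    rw [kernForm_apply]
    fin_cases j <;> simp [vec]
  rw [smul_apply, this, smul_eq_mul]
  push_cast
  field_simp

theorem Adm.sub {f g : ℝ × ℂ → ℂ} (hf : Adm f) (hg : Adm g) : Adm fun p => f p - g p where
  meas := hf.meas.sub hg.meas
  supp p hp := by rw [hf.supp p hp, hg.supp p hp, sub_zero]
  integrable c hc := by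
    refine ((hf.integrable c hc).add (hg.integrable c hc)).mono' ?_ (ae_of_all _ fun p => ?_)
    · exact (by fun_prop : Continuous fun p : ℝ × ℂ =>
        Real.exp (-c * p.1)).aestronglyMeasurable.mul (hf.meas.sub hg.meas).norm
    · rw [norm_mul, Real.norm_eq_abs, Real.abs_exp, norm_norm, Pi.add_apply, ← mul_add]
      exact mul_le_mul_of_nonneg_left (norm_sub_le _ _) (Real.exp_pos _).le

/-- The symbol of the Box operator. -/
noncomputable def boxSymbol (p : ℝ × ℂ) : ℝ := (2 * Real.pi) ^ 2 * (p.1 ^ 2 - ‖p.2‖ ^ 2)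

theorem Adm.boxOp_laplace {f : ℝ × ℂ → ℂ} (hf : Adm f) {F : (Fin 3 → ℂ) → ℂ}
    (hF : EqOn F (laplace f) (tubeDomain lorentzCone)) :
    Adm (fun p => (boxSymbol p : ℂ) * f p) ∧
    EqOn (boxOp F) (laplace fun p => (boxSymbol p : ℂ) * f p) (tubeDomain lorentzCone) := by
  have a : ∀ j, Adm fun p => (2 * Real.pi * vec p j : ℝ) * ((2 * Real.pi * vec p j : ℝ) * f p) :=
    fun j => (hf.vec_mul j).vec_mul j
  have e : ∀ j, EqOn (momentum j (momentum j F)) _ (tubeDomain lorentzCone) := fun j =>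
    (hf.vec_mul j).momentum_laplace (hf.momentum_laplace hF j) j
  have hs : (fun p => (boxSymbol p : ℂ) * f p) = fun p =>
      (2 * Real.pi * vec p 0 : ℝ) * ((2 * Real.pi * vec p 0 : ℝ) * f p) -
      (2 * Real.pi * vec p 1 : ℝ) * ((2 * Real.pi * vec p 1 : ℝ) * f p) -
      (2 * Real.pi * vec p 2 : ℝ) * ((2 * Real.pi * vec p 2 : ℝ) * f p) := by
    ext p
    have h : ‖p.2‖ ^ 2 = p.2.re ^ 2 + p.2.im ^ 2 := by
      rw [Complex.sq_norm, Complex.normSq_apply]; ring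
    simp only [boxSymbol, h, vec, Matrix.cons_val_zero, Matrix.cons_val_one, Matrix.cons_val]
    push_cast; ring
  rw [hs]
  refine ⟨((a 0).sub (a 1)).sub (a 2), fun z hz => ?_⟩
  rw [boxOp, e 0 hz, e 1 hz, e 2 hz]
  obtain ⟨x, y, rfl⟩ := exists_pt_eq z
  rw [pt_mem_tubeDomain] at hz
  have i := fun j => (a j).integrable_kern x hz
  simp only [laplace]
  rw [← integral_sub (i 0) (i 1), ← integral_sub (by exact (i 0).sub (i 1)) (i 2)]
  congr 1; ext p
  ring

theorem Adm.boxOp_iterate_laplace {f : ℝ × ℂ → ℂ} (hf : Adm f) {F : (Fin 3 → ℂ) → ℂ}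
    (hF : EqOn F (laplace f) (tubeDomain lorentzCone)) (m : ℕ) :
    Adm (fun p => (boxSymbol p : ℂ) ^ m * f p) ∧
    EqOn (boxOp^[m] F) (laplace fun p => (boxSymbol p : ℂ) ^ m * f p)
      (tubeDomain lorentzCone) := by
  induction m with
  | zero => simpa using ⟨hf, hF⟩
  | succ m ih =>
    rw [Function.iterate_succ']
    have := ih.1.boxOp_laplace ih.2
    have e : (fun p => (boxSymbol p : ℂ) ^ (m + 1) * f p) = fun p =>
        (boxSymbol p : ℂ) * ((boxSymbol p : ℂ) ^ m * f p) := by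
      ext p; ring
    rw [e]; exact this

theorem lintegral_exp_closedCone_lt_top {c : ℝ} (hc : 0 < c) :
    ∫⁻ p in closedCone, ‖Real.exp (-c * p.1)‖ₑ ^ 2 < ∞ := by
  have hi : Integrable fun p : ℝ × ℂ => (1 + ‖p‖) ^ (-(4:ℝ)) := by
    have : (volume : Measure (ℝ × ℂ)).IsAddHaarMeasure :=
      inferInstanceAs ((volume : Measure ℝ).prod (volume : Measure ℂ)).IsAddHaarMeasure
    refine integrable_one_add_norm ?_
    have : Module.finrank ℝ (ℝ × ℂ) = 3 := by
      rw [Module.finrank_prod, Module.finrank_self, Complex.finrank_real_complex]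
    rw [this]; norm_num
  -- Chosen so that `1 + p.1 ≤ M e^{c p.1 / 2}`; the fourth power then cancels the squared
  -- exponential and leaves the majorant `M⁴ (1 + ‖p‖)⁻⁴`, integrable in dimension 3. On the closed
  -- cone the sup norm of `p` is `p.1`.
  set M : ℝ := max 1 (2 / c) with hM
  have hM1 : 1 ≤ M := le_max_left _ _
  have hMc : 2 ≤ M * c := by
    have := le_max_right 1 (2 / c)
    rwa [div_le_iff₀ hc, ← hM] at this
  have hi2 := (hi.const_mul (M ^ 4)).lintegral_lt_top
  refine lt_of_le_of_lt ?_ hi2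
  refine (setLIntegral_mono' isClosed_closedCone.measurableSet fun p hp => ?_).trans
    (setLIntegral_le_lintegral _ _)
  have h0 : 0 ≤ p.1 := (norm_nonneg _).trans hp
  have hn : ‖p‖ = p.1 := by
    rw [Prod.norm_def, Real.norm_of_nonneg h0, max_eq_left hp]
  rw [hn, Real.enorm_eq_ofReal (Real.exp_pos _).le, ← ENNReal.ofReal_pow (Real.exp_pos _).le]
  apply ENNReal.ofReal_le_ofReal
  have h1 : 1 + p.1 ≤ M * Real.exp (c / 2 * p.1) := by
    have := Real.add_one_le_exp (c / 2 * p.1)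
    have h3 := mul_le_mul_of_nonneg_left this (zero_le_one.trans hM1)
    nlinarith [mul_le_mul_of_nonneg_right hMc h0]
  have hpos : 0 < 1 + p.1 := by linarith
  rw [Real.rpow_neg hpos.le, ← div_eq_mul_inv, le_div_iff₀ (by positivity)]
  have h4 : (1 + p.1) ^ (4:ℝ) ≤ (M * Real.exp (c / 2 * p.1)) ^ 4 := by
    rw [show (4:ℝ) = ((4:ℕ):ℝ) by norm_num, Real.rpow_natCast]
    exact pow_le_pow_left₀ hpos.le h1 4
  calc _ ≤ Real.exp (-c * p.1) ^ 2 * (M * Real.exp (c / 2 * p.1)) ^ 4 := by gcongr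
    _ = M ^ 4 * (Real.exp (-c * p.1) ^ 2 * Real.exp (c / 2 * p.1) ^ 4) := by ring
    _ = M ^ 4 := by
      rw [← Real.exp_nat_mul, ← Real.exp_nat_mul, ← Real.exp_add]
      push_cast
      rw [show 2 * (-c * p.1) + 4 * (c / 2 * p.1) = 0 by ring, Real.exp_zero, mul_one]

theorem Adm.of_memLp {f : ℝ × ℂ → ℂ} (hf : MemLp f 2) (hs : ∀ p, p ∉ closedCone → f p = 0) :
    Adm f where
  meas := hf.1
  supp := hs
  integrable c hc := by
    have h1 : MemLp (closedCone.indicator fun p : ℝ × ℂ => ((Real.exp (-c * p.1) : ℝ) : ℂ)) 2 := by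
      refine memLp_two_iff.2 ⟨(by fun_prop : Continuous fun p : ℝ × ℂ =>
        ((Real.exp (-c * p.1) : ℝ) : ℂ)).aestronglyMeasurable.indicator
          isClosed_closedCone.measurableSet, ?_⟩
      refine lt_of_eq_of_lt ?_ (lintegral_exp_closedCone_lt_top hc)
      rw [← lintegral_indicator isClosed_closedCone.measurableSet]
      refine lintegral_congr fun p => ?_
      by_cases hp : p ∈ closedCone
      · simp only [indicator_of_mem hp]
        rw [← ofReal_norm, ← ofReal_norm, norm_real]
      · simp [indicator_of_notMem hp]
    refine (h1.integrable_mul hf).norm.congr (ae_of_all _ fun p => ?_)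
    by_cases hp : p ∈ closedCone
    · simp only [Pi.mul_apply, indicator_of_mem hp, norm_mul, norm_real, Real.norm_eq_abs,
        Real.abs_exp]
    · simp [hs p hp]

/-! ### Plancherel on slices and limits of damped norms -/

/-- `ℝ³` as a Euclidean space. -/
abbrev E3 : Type := WithLp 2 (ℝ × ℂ)

theorem inner_E3 (v w : E3) : inner ℝ v w = dot v.ofLp w.ofLp := by
  rw [WithLp.prod_inner_apply, dot]
  simp [Complex.inner]
  ring

theorem measurePreserving_ofLp : MeasurePreserving (fun v : E3 => v.ofLp) :=
  WithLp.volume_preserving_ofLp ℝ ℂ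

theorem measurePreserving_toLp : MeasurePreserving (fun p : ℝ × ℂ => (WithLp.toLp 2 p : E3)) :=
  WithLp.volume_preserving_toLp ℝ ℂ

theorem measurableEmbedding_ofLp : MeasurableEmbedding (fun v : E3 => v.ofLp) :=
  (MeasurableEquiv.toLp 2 (ℝ × ℂ)).symm.measurableEmbedding

/-- The function whose inverse Fourier transform is the slice of `laplace f` at height `y`. -/
noncomputable def damp (y : ℝ × ℂ) (f : ℝ × ℂ → ℂ) (p : ℝ × ℂ) : ℂ :=
  Real.exp (-2 * Real.pi * dot y p) * f p

theorem laplace_pt (f : ℝ × ℂ → ℂ) (x y : ℝ × ℂ) :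
    laplace f (pt x y) = 𝓕⁻ (fun v : E3 => damp y f v.ofLp) (WithLp.toLp 2 x) := by
  rw [Real.fourierInv_eq', laplace,
    ← measurePreserving_ofLp.integral_comp measurableEmbedding_ofLp]
  congr 1; ext v
  rw [kern_pt, inner_E3, smul_eq_mul, damp, show dot v.ofLp (WithLp.toLp 2 x : E3).ofLp =
    dot x v.ofLp by simp only [dot]; ring]
  push_cast
  ring

theorem Adm.integrable_damp {f : ℝ × ℂ → ℂ} (hf : Adm f) {y : ℝ × ℂ} (hy : y ∈ cone) :
    Integrable (damp y f) := by
  have := hf.integrable_kern 0 hy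
  refine this.congr (ae_of_all _ fun p => ?_)
  simp [kern_pt, damp, dot]

theorem memLp_damp {f : ℝ × ℂ → ℂ} (hf : MemLp f 2) (hs : ∀ p, p ∉ closedCone → f p = 0)
    {y : ℝ × ℂ} (hy : y ∈ cone) : MemLp (damp y f) 2 := by
  refine hf.mono ?_ (ae_of_all _ fun p => ?_)
  · exact (by unfold dot; fun_prop : Continuous fun p : ℝ × ℂ =>
      ((Real.exp (-2 * Real.pi * dot y p) : ℝ) : ℂ)).aestronglyMeasurable.mul hf.1
  · by_cases hp : p ∈ closedCone
    · rw [damp, norm_mul, norm_real, Real.norm_eq_abs, Real.abs_exp]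
      refine mul_le_of_le_one_left (norm_nonneg _) (Real.exp_le_one_iff.2 ?_)
      have h0 : 0 ≤ p.1 := (norm_nonneg _).trans hp
      have := (mul_nonneg (sub_pos.2 hy).le h0).trans (le_dot hp y)
      nlinarith [Real.pi_pos]
    · simp [damp, hs p hp]

theorem lintegral_laplace_pt {f : ℝ × ℂ → ℂ} {y : ℝ × ℂ} (h1 : Integrable (damp y f))
    (h2 : MemLp (damp y f) 2) :
    ∫⁻ x, ‖laplace f (pt x y)‖ₑ ^ 2 = ∫⁻ p, ‖damp y f p‖ₑ ^ 2 := by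
  have h1' : Integrable fun v : E3 => damp y f v.ofLp :=
    measurePreserving_ofLp.integrable_comp_of_integrable h1
  have h2' : MemLp (fun v : E3 => damp y f v.ofLp) 2 :=
    h2.comp_measurePreserving measurePreserving_ofLp
  rw [← measurePreserving_ofLp.lintegral_comp_emb measurableEmbedding_ofLp,
    ← measurePreserving_ofLp.lintegral_comp_emb measurableEmbedding_ofLp (fun p => ‖damp y f p‖ₑ ^ 2),
    ← lintegral_enorm_sq_fourierInv h1' h2']
  simp only [laplace_pt]

theorem lintegral_le_of_tendsto {α : Type*} {m : MeasurableSpace α} {μ : Measure α}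
    {g : ℕ → α → ℝ≥0∞} {h : α → ℝ≥0∞} {N : ℝ≥0∞} (hg : ∀ n, AEMeasurable (g n) μ)
    (hlim : ∀ᵐ p ∂μ, Filter.Tendsto (fun n => g n p) Filter.atTop (nhds (h p)))
    (hN : ∀ n, ∫⁻ p, g n p ∂μ ≤ N) : ∫⁻ p, h p ∂μ ≤ N := by
  rw [← lintegral_congr_ae (hlim.mono fun p hp => hp.liminf_eq)]
  refine (lintegral_liminf_le' hg).trans ?_
  refine (Filter.liminf_le_liminf (Filter.Eventually.of_forall hN)).trans ?_
  simp

theorem measurable_damp (y : ℝ × ℂ) {f : ℝ × ℂ → ℂ} (hf : AEStronglyMeasurable f) :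
    AEMeasurable fun p => ‖damp y f p‖ₑ ^ 2 :=
  ((by unfold dot; fun_prop : Continuous fun p : ℝ × ℂ =>
      ((Real.exp (-2 * Real.pi * dot y p) : ℝ) : ℂ)).aestronglyMeasurable.mul hf).enorm.pow_const 2

/-- Fatou's lemma as `y` tends to `0` along the axis of the cone. -/
theorem lintegral_le_of_damp_le {f : ℝ × ℂ → ℂ} (hf : AEStronglyMeasurable f) {N : ℝ≥0∞}
    (h : ∀ y ∈ cone, ∫⁻ p, ‖damp y f p‖ₑ ^ 2 ≤ N) : ∫⁻ p, ‖f p‖ₑ ^ 2 ≤ N := by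
  refine lintegral_le_of_tendsto (g := fun n p => ‖damp (1 / ((n : ℝ) + 1), 0) f p‖ₑ ^ 2)
    (fun n => measurable_damp _ hf) (ae_of_all _ fun p => ?_) fun n => h _ ?_
  · have h1 : Filter.Tendsto (fun n : ℕ => damp (1 / ((n : ℝ) + 1), 0) f p) Filter.atTop
        (nhds (damp (0, 0) f p)) := by
      have hc : Continuous fun r : ℝ => damp (r, 0) f p := by unfold damp dot; fun_prop
      exact (hc.tendsto 0).comp tendsto_one_div_add_atTop_nhds_zero_nat
    have h2 : damp (0, 0) f p = f p := by simp [damp, dot]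
    rw [h2] at h1
    exact ENNReal.Tendsto.pow ((continuous_enorm.tendsto _).comp h1)
  · simp only [cone, mem_ofPred_eq, norm_zero]; positivity

/-- Going to infinity along the ray through `y`, the damped square blows up wherever `dot y p < 0`
and `f p ≠ 0`. By Fatou, infinity integrated over that set is at most `N`, so the set is null. -/
theorem ae_eq_zero_of_damp_le {f : ℝ × ℂ → ℂ} (hf : StronglyMeasurable f) {N : ℝ≥0∞}
    (hN : N < ∞) {y : ℝ × ℂ} (h : ∀ n : ℕ, ∫⁻ p, ‖damp (((n : ℝ) + 1) • y) f p‖ₑ ^ 2 ≤ N) :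
    ∀ᵐ p, dot y p < 0 → f p = 0 := by
  set A : Set (ℝ × ℂ) := {p | dot y p < 0 ∧ f p ≠ 0} with hA
  have hAm : MeasurableSet A :=
    (measurableSet_lt (f := fun p => dot y p) (by unfold dot; fun_prop) measurable_const).inter
      (hf.measurable (measurableSet_singleton 0).compl)
  have key : ∫⁻ p in A, (∞ : ℝ≥0∞) ≤ N := by
    refine lintegral_le_of_tendsto (g := fun n p => ‖damp (((n : ℝ) + 1) • y) f p‖ₑ ^ 2)
      (fun n => (measurable_damp _ hf.aestronglyMeasurable).restrict) ?_
      fun n => (setLIntegral_le_lintegral _ _).trans (h n)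
    filter_upwards [ae_restrict_mem hAm] with p hp
    have e : ∀ n : ℕ, ‖damp (((n : ℝ) + 1) • y) f p‖ₑ ^ 2 =
        ENNReal.ofReal (Real.exp (-4 * Real.pi * dot y p * ((n : ℝ) + 1)) * ‖f p‖ ^ 2) := fun n => by
      rw [← ofReal_norm, ← ENNReal.ofReal_pow (norm_nonneg _), damp, norm_mul, norm_real,
        Real.norm_eq_abs, Real.abs_exp, mul_pow, ← Real.exp_nat_mul]
      congr 3
      simp only [dot, Prod.smul_fst, Prod.smul_snd, smul_re, smul_im, smul_eq_mul]
      push_cast; ring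
    simp only [e]
    refine ENNReal.tendsto_ofReal_atTop.comp ?_
    refine Filter.Tendsto.atTop_mul_const (by have := norm_pos_iff.2 hp.2; positivity) ?_
    refine Real.tendsto_exp_atTop.comp ?_
    refine Filter.Tendsto.const_mul_atTop (by nlinarith [hp.1, Real.pi_pos]) ?_
    exact Filter.tendsto_atTop_add_const_right _ _ tendsto_natCast_atTop_atTop
  have h0 : volume A = 0 := by
    by_contra h0
    rw [setLIntegral_const, ENNReal.top_mul h0] at key
    exact absurd (key.trans_lt hN) (lt_irrefl _)
  rw [measure_eq_zero_iff_ae_notMem] at h0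
  filter_upwards [h0] with p hp hd
  by_contra hne
  exact hp ⟨hd, hne⟩

theorem pow_half_sq (a : ℝ≥0∞) : (a ^ (1 / 2 : ℝ)) ^ 2 = a := by
  rw [← ENNReal.rpow_natCast, ← ENNReal.rpow_mul]; norm_num

/-- The Laplace transform maps `L²` functions on the closed cone isometrically to `H²`. -/
theorem memHardy_laplace {f : ℝ × ℂ → ℂ} (hf : MemLp f 2) (hs : ∀ p, p ∉ closedCone → f p = 0) :
    MemHardy lorentzCone (laplace f) ∧
      hardyENorm lorentzCone (laplace f) ^ 2 = ∫⁻ p, ‖f p‖ₑ ^ 2 := by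
  have ha := Adm.of_memLp hf hs
  have hslice : ∀ y ∈ cone, ∫⁻ x, ‖laplace f (pt x y)‖ₑ ^ 2 = ∫⁻ p, ‖damp y f p‖ₑ ^ 2 :=
    fun y hy => lintegral_laplace_pt (ha.integrable_damp hy) (memLp_damp hf hs hy)
  have hnorm : hardyENorm lorentzCone (laplace f) ^ 2 = ∫⁻ p, ‖f p‖ₑ ^ 2 := by
    rw [hardyENorm_sq]
    refine le_antisymm (iSup₂_le fun y hy => ?_) (lintegral_le_of_damp_le hf.1 fun y hy => ?_)
    · rw [hslice y hy]
      refine lintegral_mono fun p => ?_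
      gcongr
      by_cases hp : p ∈ closedCone
      · rw [← ofReal_norm, ← ofReal_norm]
        apply ENNReal.ofReal_le_ofReal
        rw [damp, norm_mul, norm_real, Real.norm_eq_abs, Real.abs_exp]
        refine mul_le_of_le_one_left (norm_nonneg _) (Real.exp_le_one_iff.2 ?_)
        have h0 : 0 ≤ p.1 := (norm_nonneg _).trans hp
        have := (mul_nonneg (sub_pos.2 hy).le h0).trans (le_dot hp y)
        nlinarith [Real.pi_pos]
      · simp [damp, hs p hp]
    · rw [← hslice y hy]
      exact le_iSup₂ (f := fun y (_ : y ∈ cone) => ∫⁻ x, ‖laplace f (pt x y)‖ₑ ^ 2) y hy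
  refine ⟨⟨ha.differentiableOn_laplace, ?_⟩, hnorm⟩
  have := (memLp_two_iff.1 hf).2
  rw [← hnorm] at this
  exact (ENNReal.pow_lt_top_iff.1 this).resolve_right (by norm_num)

/-! ### Paley–Wiener for the tube -/

section PaleyWiener

variable {F : (Fin 3 → ℂ) → ℂ}

theorem pt_add_smul (x y v : ℝ × ℂ) (w : ℂ) :
    pt (x + w.re • v) (y + w.im • v) = pt x y + w • fun j => (vec v j : ℂ) := by
  ext j
  have hv : ∀ (a b : ℝ × ℂ) (r : ℝ), vec (a + r • b) j = vec a j + r * vec b j := fun a b r => by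
    fin_cases j <;> simp [vec]
  simp only [pt, hv, Pi.add_apply, Pi.smul_apply, smul_eq_mul]
  push_cast
  nth_rewrite 3 [← re_add_im w]
  ring

theorem continuous_pt : Continuous fun q : (ℝ × ℂ) × (ℝ × ℂ) => pt q.1 q.2 := by
  refine continuous_pi fun j => ?_
  fin_cases j <;> simp only [pt, vec] <;> simp <;> fun_prop

theorem continuous_slice (hF : DifferentiableOn ℂ F (tubeDomain lorentzCone)) {y : ℝ × ℂ}
    (hy : y ∈ cone) : Continuous fun v : E3 => F (pt v.ofLp y) := by
  have h : Continuous fun v : E3 => pt v.ofLp y :=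
    continuous_pt.comp (f := fun v : E3 => (v.ofLp, y)) (by fun_prop)
  exact hF.continuousOn.comp_continuous h fun v => pt_mem_tubeDomain.2 hy

theorem lintegral_slice_le {y : ℝ × ℂ} (hy : y ∈ cone) :
    ∫⁻ v : E3, ‖F (pt v.ofLp y)‖ₑ ^ 2 ≤ hardyENorm lorentzCone F ^ 2 := by
  rw [measurePreserving_ofLp.lintegral_comp_emb measurableEmbedding_ofLp
    (fun x => ‖F (pt x y)‖ₑ ^ 2), hardyENorm_sq]
  exact le_iSup₂ (f := fun y (_ : y ∈ cone) => ∫⁻ x, ‖F (pt x y)‖ₑ ^ 2) y hy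

theorem memLp_slice (hF : MemHardy lorentzCone F) {y : ℝ × ℂ} (hy : y ∈ cone) :
    MemLp (fun v : E3 => F (pt v.ofLp y)) 2 :=
  memLp_two_iff.2 ⟨(continuous_slice hF.1 hy).aestronglyMeasurable,
    (lintegral_slice_le hy).trans_lt (ENNReal.pow_lt_top hF.2)⟩

theorem convex_cone : Convex ℝ cone := by
  intro a ha b hb s t hs ht hst
  simp only [cone, mem_ofPred_eq] at *
  have h1 : ‖(s • a + t • b).2‖ ≤ s * ‖a.2‖ + t * ‖b.2‖ := by
    refine (norm_add_le _ _).trans (add_le_add ?_ ?_) <;>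
    · rw [Prod.smul_snd, norm_smul, Real.norm_of_nonneg ‹_›]
  refine h1.trans_lt ?_
  simp only [Prod.fst_add, Prod.smul_fst, smul_eq_mul]
  rcases hs.eq_or_lt with rfl | hs'
  · have : t = 1 := by linarith
    subst this; linarith
  · have := mul_lt_mul_of_pos_left ha hs'
    have := mul_le_mul_of_nonneg_left hb.le ht
    linarith

/-- The cone is convex, so the segment from `y₀` to `y` stays in it; the Hardy norm bounds all
intermediate slices uniformly. -/
theorem fourier_slice_hardy (hF : MemHardy lorentzCone F) {y₀ y : ℝ × ℂ} (hy₀ : y₀ ∈ cone)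
    (hy : y ∈ cone) :
    (𝓕 ((memLp_slice hF hy).toLp _) : Lp (α := E3) ℂ 2 volume) =ᵐ[volume] fun t =>
      (Real.exp (2 * Real.pi * (dot y₀ t.ofLp - dot y t.ofLp)) : ℂ) *
        (𝓕 ((memLp_slice hF hy₀).toLp _) : Lp (α := E3) ℂ 2 volume) t := by
  set v : E3 := WithLp.toLp 2 (y - y₀) with hv
  have hseg : ∀ s ∈ Icc (0:ℝ) 1, y₀ + s • (y - y₀) ∈ cone := fun s hs => by
    have := convex_cone hy₀ hy (sub_nonneg.2 hs.2) hs.1 (by ring)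
    convert this using 1
    module
  let Φ : E3 → ℝ → ℂ := fun x s => F (pt x.ofLp (y₀ + s • (y - y₀)))
  have hΦ0 : (fun x => Φ x 0) = fun x : E3 => F (pt x.ofLp y₀) := by ext x; simp [Φ]
  have hΦ1 : (fun x => Φ x 1) = fun x : E3 => F (pt x.ofLp y) := by ext x; simp [Φ]
  have hcont : ContinuousOn (Function.uncurry Φ) (univ ×ˢ Ioc 0 1) := by
    refine hF.1.continuousOn.comp (Continuous.continuousOn ?_) fun q hq => ?_
    · exact continuous_pt.comp
        (f := fun q : E3 × ℝ => (q.1.ofLp, y₀ + q.2 • (y - y₀))) (by fun_prop)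
    · exact pt_mem_tubeDomain.2 (hseg _ ⟨hq.2.1.le, hq.2.2⟩)
  have h := fourier_slice_eq v Φ (fun x => ?_) ?_ (by rw [hΦ0]; exact continuous_slice hF.1 hy₀)
    (by rw [hΦ1]; exact continuous_slice hF.1 hy) (by rw [hΦ0]; exact memLp_slice hF hy₀)
    (by rw [hΦ1]; exact memLp_slice hF hy) ?_
  · simp only [hΦ0, hΦ1] at h
    filter_upwards [h] with t ht
    rw [ht, ← mul_assoc, ← ofReal_mul, ← Real.exp_add, inner_E3]
    have : 2 * Real.pi * (dot y₀ t.ofLp - dot y t.ofLp) + 2 * Real.pi * dot v.ofLp t.ofLp = 0 := by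
      simp [hv, dot]; ring
    rw [this]; simp
  · simp only [Φ]
    have e : ∀ w : ℂ, pt (x + w.re • v).ofLp (y₀ + w.im • (y - y₀)) =
        pt x.ofLp y₀ + w • fun j => (vec (y - y₀) j : ℂ) := fun w => by
      rw [← pt_add_smul]; rfl
    simp only [e]
    refine hF.1.comp (by fun_prop) fun w hw => ?_
    rw [← e]
    exact pt_mem_tubeDomain.2 (hseg _ hw)
  · have hr : (volume : Measure E3).prod (volume.restrict (Ioc (0:ℝ) 1)) =
        (volume.prod volume).restrict (univ ×ˢ Ioc 0 1) := by
      rw [← Measure.prod_restrict, Measure.restrict_univ]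
    rw [hr]
    exact hcont.aestronglyMeasurable (MeasurableSet.univ.prod measurableSet_Ioc)
  · refine (setLIntegral_mono' measurableSet_Ioc fun s hs =>
      lintegral_slice_le (F := F) (hseg s ⟨hs.1.le, hs.2⟩)).trans_lt ?_
    simpa using (ENNReal.pow_lt_top hF.2 : hardyENorm lorentzCone F ^ 2 < ∞)

/-- **Paley–Wiener theorem** for the Hardy space of the tube over the Lorentz cone. -/
theorem exists_laplace_of_memHardy (hF : MemHardy lorentzCone F) :
    ∃ f : ℝ × ℂ → ℂ, StronglyMeasurable f ∧ MemLp f 2 ∧ (∀ p, p ∉ closedCone → f p = 0) ∧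
      EqOn F (laplace f) (tubeDomain lorentzCone) ∧
      ∫⁻ p, ‖f p‖ₑ ^ 2 ≤ hardyENorm lorentzCone F ^ 2 := by
  have h1 : ((1, 0) : ℝ × ℂ) ∈ cone := by simp [cone]
  set N := hardyENorm lorentzCone F ^ 2 with hN
  have hNt : N < ∞ := ENNReal.pow_lt_top hF.2
  let H : Lp (α := E3) ℂ 2 volume := 𝓕 ((memLp_slice hF h1).toLp _)
  -- Undoing the damping at the reference height `(1, 0)`; the transform of every other slice is
  -- then `damp y f`.
  let f : ℝ × ℂ → ℂ := fun p => (Real.exp (2 * Real.pi * dot (1, 0) p) : ℂ) * H (WithLp.toLp 2 p)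
  have hfm : StronglyMeasurable f := by
    refine StronglyMeasurable.mul (Continuous.stronglyMeasurable (by unfold dot; fun_prop)) ?_
    exact (Lp.stronglyMeasurable H).comp_measurable measurePreserving_toLp.measurable
  have hft : ∀ y (hy : y ∈ cone), (𝓕 ((memLp_slice hF hy).toLp _) : Lp (α := E3) ℂ 2 volume)
      =ᵐ[volume] fun t => damp y f t.ofLp := fun y hy => by
    filter_upwards [fourier_slice_hardy hF h1 hy] with t ht
    rw [ht, damp, ← mul_assoc, ← ofReal_mul, ← Real.exp_add]
    congr 4
    ring
  have hdamp : ∀ y ∈ cone, ∫⁻ p, ‖damp y f p‖ₑ ^ 2 ≤ N := fun y hy => by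
    rw [← measurePreserving_ofLp.lintegral_comp_emb measurableEmbedding_ofLp]
    have e := lintegral_enorm_sq_fourier_Lp ((memLp_slice hF hy).toLp _)
    have e3 : ∫⁻ t : E3, ‖((memLp_slice hF hy).toLp _ : Lp (α := E3) ℂ 2 volume) t‖ₑ ^ 2 =
        ∫⁻ t : E3, ‖F (pt t.ofLp y)‖ₑ ^ 2 :=
      lintegral_congr_ae ((memLp_slice hF hy).coeFn_toLp.mono fun t ht => by simp only [ht])
    rw [lintegral_congr_ae (g := fun t : E3 => ‖damp y f t.ofLp‖ₑ ^ 2)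
      ((hft y hy).mono fun t ht => by simp only [ht]), e3] at e
    rw [e]
    exact lintegral_slice_le hy
  have hsupp : ∀ᵐ p, p ∉ closedCone → f p = 0 := by
    -- The exceptional null set depends on `y`, so only countably many `y` are used. This suffices
    -- because, for fixed `p`, the `y` in the cone with `dot y p < 0` form an open set.
    have hall : ∀ᵐ p, ∀ k, TopologicalSpace.denseSeq (ℝ × ℂ) k ∈ cone →
        dot (TopologicalSpace.denseSeq (ℝ × ℂ) k) p < 0 → f p = 0 := by
      refine ae_all_iff.2 fun k => ?_
      by_cases hk : TopologicalSpace.denseSeq (ℝ × ℂ) k ∈ cone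
      · refine (ae_eq_zero_of_damp_le hfm hNt fun n => hdamp _ ?_).mono fun p hp _ => hp
        have hn : (0:ℝ) < (n:ℝ) + 1 := by positivity
        simp only [cone, mem_ofPred_eq, Prod.smul_snd, Prod.smul_fst, norm_smul,
          Real.norm_of_nonneg hn.le, smul_eq_mul]
        exact mul_lt_mul_of_pos_left hk hn
      · exact ae_of_all _ fun p h => absurd h hk
    filter_upwards [hall] with p hp hpc
    obtain ⟨y, hy, hyp⟩ := exists_dot_neg hpc
    have hopen : IsOpen (cone ∩ {y | dot y p < 0}) :=
      isOpen_cone.inter (isOpen_lt (by unfold dot; fun_prop) continuous_const)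
    obtain ⟨k, hk⟩ := (TopologicalSpace.denseRange_denseSeq (ℝ × ℂ)).exists_mem_open hopen
      ⟨y, hy, hyp⟩
    exact hp k hk.1 hk.2
  let f' : ℝ × ℂ → ℂ := closedCone.indicator f
  have hff' : f' =ᵐ[volume] f := hsupp.mono fun p hp => by
    by_cases h : p ∈ closedCone
    · exact indicator_of_mem h f
    · rw [hp h]; exact indicator_of_notMem h f
  have hle : ∫⁻ p, ‖f p‖ₑ ^ 2 ≤ N := lintegral_le_of_damp_le hfm.aestronglyMeasurable hdamp
  have hle' : ∫⁻ p, ‖f' p‖ₑ ^ 2 ≤ N := by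
    rw [lintegral_congr_ae (g := fun p => ‖f p‖ₑ ^ 2) (hff'.mono fun p hp => by simp only [hp])]
    exact hle
  have hL2 : MemLp f' 2 := memLp_two_iff.2
    ⟨(hfm.indicator isClosed_closedCone.measurableSet).aestronglyMeasurable, hle'.trans_lt hNt⟩
  have hs' : ∀ p, p ∉ closedCone → f' p = 0 := fun p hp => indicator_of_notMem hp f
  have ha := Adm.of_memLp hL2 hs'
  refine ⟨f', hfm.indicator isClosed_closedCone.measurableSet, hL2, hs', fun z hz => ?_, hle'⟩
  obtain ⟨x, y, rfl⟩ := exists_pt_eq z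
  rw [pt_mem_tubeDomain] at hz
  have i1 : Integrable fun v : E3 => damp y f' v.ofLp :=
    measurePreserving_ofLp.integrable_comp_of_integrable (ha.integrable_damp hz)
  have i2 : MemLp (fun v : E3 => damp y f' v.ofLp) 2 :=
    (memLp_damp hL2 hs' hz).comp_measurePreserving measurePreserving_ofLp
  have hft' : (𝓕 ((memLp_slice hF hz).toLp _) : Lp (α := E3) ℂ 2 volume)
      =ᵐ[volume] fun t => damp y f' t.ofLp := by
    filter_upwards [hft y hz, measurePreserving_ofLp.quasiMeasurePreserving.ae hff'] with t h1 h2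
    rw [h1, damp, damp, h2]
  have hinv := ae_eq_fourierInv_of_fourier_ae_eq (memLp_slice hF hz) i1 i2 hft'
  have hlap : (fun v : E3 => 𝓕⁻ (fun v : E3 => damp y f' v.ofLp) v) =
      fun v : E3 => laplace f' (pt v.ofLp y) := by
    ext v; rw [laplace_pt]
  -- Both slices are continuous, so almost everywhere equality is equality.
  have heq := (continuous_slice hF.1 hz).ae_eq_iff_eq volume
    (continuous_slice ha.differentiableOn_laplace hz) |>.1 (by rw [← hlap]; exact hinv)
  exact congrFun heq (WithLp.toLp 2 x)

end PaleyWiener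

/-! ### Densities and Bergman norms on the half-plane -/

/-- The one-variable Fourier–Laplace transform. -/
noncomputable def laplaceLine (g : ℝ → ℂ) (z : ℂ) : ℂ :=
  ∫ t : ℝ, cexp (2 * Real.pi * I * (z * t)) * g t

noncomputable def dampLine (y : ℝ) (g : ℝ → ℂ) (t : ℝ) : ℂ := Real.exp (-2 * Real.pi * y * t) * g t

theorem laplaceLine_add_mul_I (g : ℝ → ℂ) (x y : ℝ) :
    laplaceLine g (x + y * I) = 𝓕⁻ (dampLine y g) x := by
  rw [Real.fourierInv_eq', laplaceLine]
  congr 1; ext t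
  rw [smul_eq_mul, dampLine, ofReal_exp, ← mul_assoc (cexp _) (cexp _) (g t), ← Complex.exp_add]
  congr 2
  simp only [RCLike.inner_apply, conj_trivial]
  push_cast
  linear_combination 2 * (Real.pi : ℂ) * y * t * I_mul_I

theorem bergmanENorm_sq (α : ℝ) {G : ℂ → ℂ} (hG : ContinuousOn G upperHalf) :
    bergmanENorm α G ^ 2 =
      ∫⁻ y in Ioi (0:ℝ), ENNReal.ofReal (y ^ α) * ∫⁻ x : ℝ, ‖G (x + y * I)‖ₑ ^ 2 := by
  rw [bergmanENorm, pow_half_sq]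
  have mp := Complex.volume_preserving_equiv_real_prod.symm
  have me := Complex.measurableEquivRealProd.symm.measurableEmbedding
  have hpre : Complex.measurableEquivRealProd.symm ⁻¹' upperHalf = univ ×ˢ Ioi (0:ℝ) := by
    ext p; simp [upperHalf, Complex.measurableEquivRealProd_symm_apply]
  have hz : ∀ p : ℝ × ℝ, Complex.measurableEquivRealProd.symm p = p.1 + p.2 * I := fun p => by
    rw [Complex.measurableEquivRealProd_symm_apply, Complex.mk_eq_add_mul_I]
  rw [← mp.setLIntegral_comp_preimage_emb me, hpre]
  have hcont : ContinuousOn (fun p : ℝ × ℝ => G (p.1 + p.2 * I)) (univ ×ˢ Ioi (0:ℝ)) :=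
    hG.comp (Continuous.continuousOn (by fun_prop)) fun p hp => by
      simpa [upperHalf] using hp.2
  have hr : (volume : Measure (ℝ × ℝ)).restrict (univ ×ˢ Ioi (0:ℝ)) =
      (volume : Measure ℝ).prod (volume.restrict (Ioi (0:ℝ))) := by
    rw [Measure.volume_eq_prod, ← Measure.prod_restrict, Measure.restrict_univ]
  have hm : AEMeasurable (fun p : ℝ × ℝ => ‖G (p.1 + p.2 * I)‖ₑ ^ 2 * ENNReal.ofReal (p.2 ^ α))
      ((volume : Measure ℝ).prod (volume.restrict (Ioi (0:ℝ)))) := by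
    rw [← hr]
    have h2 : Measurable fun p : ℝ × ℝ => ENNReal.ofReal (p.2 ^ α) := by fun_prop
    refine AEMeasurable.mul ?_ h2.aemeasurable
    exact (hcont.aestronglyMeasurable (MeasurableSet.univ.prod measurableSet_Ioi)).enorm.pow_const 2
  rw [hr]
  have e : ∀ p : ℝ × ℝ, ‖G (Complex.measurableEquivRealProd.symm p)‖ₑ ^ 2 *
      ENNReal.ofReal ((Complex.measurableEquivRealProd.symm p).im ^ α) =
      ‖G (p.1 + p.2 * I)‖ₑ ^ 2 * ENNReal.ofReal (p.2 ^ α) := fun p => by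
    rw [hz]; simp
  simp only [e]
  rw [lintegral_prod_symm _ hm]
  refine lintegral_congr fun y => ?_
  simp only
  rw [lintegral_mul_const' _ _ ENNReal.ofReal_ne_top, mul_comm]

theorem lintegral_pow_mul_exp {n : ℕ} {r : ℝ} (hr : 0 < r) :
    ∫⁻ y in Ioi (0:ℝ), ENNReal.ofReal (y ^ n * Real.exp (-(r * y))) =
      ENNReal.ofReal (Real.Gamma (n + 1) / r ^ (n + 1)) := by
  have h := Real.integral_rpow_mul_exp_neg_mul_Ioi (a := n + 1) (r := r) (by positivity) hr
  have h' : ∫ y in Ioi (0:ℝ), y ^ n * Real.exp (-(r * y)) = Real.Gamma (n + 1) / r ^ (n + 1) := by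
    rw [show ((n:ℝ) + 1) = ((n + 1 : ℕ) : ℝ) by push_cast; rfl] at h ⊢
    rw [Real.rpow_natCast] at h
    rw [div_eq_inv_mul, ← inv_pow, ← one_div, ← h]
    refine setIntegral_congr_fun measurableSet_Ioi fun y _ => ?_
    simp
  have hpos : 0 < Real.Gamma (n + 1) / r ^ (n + 1) :=
    div_pos (Real.Gamma_pos_of_pos (by positivity)) (by positivity)
  rw [← h', ofReal_integral_eq_lintegral_ofReal]
  · exact Integrable.of_integral_ne_zero (by rw [h']; exact hpos.ne')
  · filter_upwards [ae_restrict_mem measurableSet_Ioi] with y hy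
    have : (0:ℝ) < y := hy
    positivity

/-- This divergence forces the density of a Bergman function to vanish for `t ≤ 0`. -/
theorem lintegral_pow_mul_exp_eq_top {n : ℕ} {r : ℝ} (hr : r ≤ 0) :
    ∫⁻ y in Ioi (0:ℝ), ENNReal.ofReal (y ^ n * Real.exp (-(r * y))) = ∞ := by
  refine eq_top_iff.2 ?_
  calc (∞ : ℝ≥0∞) = ∫⁻ y in Ioi (1:ℝ), 1 := by simp
    _ ≤ ∫⁻ y in Ioi (1:ℝ), ENNReal.ofReal (y ^ n * Real.exp (-(r * y))) := by
      refine setLIntegral_mono' measurableSet_Ioi fun y hy => ?_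
      have hy1 : (1:ℝ) ≤ y := le_of_lt hy
      rw [ENNReal.one_le_ofReal]
      exact one_le_mul_of_one_le_of_one_le (one_le_pow₀ hy1)
        (Real.one_le_exp_iff.2 (by nlinarith))
    _ ≤ _ := lintegral_mono_set (Ioi_subset_Ioi zero_le_one)

theorem enorm_dampLine_sq (y : ℝ) (g : ℝ → ℂ) (t : ℝ) :
    ‖dampLine y g t‖ₑ ^ 2 = ‖g t‖ₑ ^ 2 * ENNReal.ofReal (Real.exp (-(4 * Real.pi * t * y))) := by
  rw [dampLine, enorm_mul, mul_pow, mul_comm, ← ofReal_norm (Complex.ofReal _), norm_real,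
    Real.norm_of_nonneg (Real.exp_pos _).le, ← ENNReal.ofReal_pow (Real.exp_pos _).le,
    ← Real.exp_nat_mul]
  congr 3
  push_cast; ring

/-- The weight obtained by integrating `y ^ n e^{-4πty}` over `y`. -/
theorem lintegral_pow_mul_dampLine (n : ℕ) {g : ℝ → ℂ} (hg : AEStronglyMeasurable g) :
    ∫⁻ y in Ioi (0:ℝ), ENNReal.ofReal (y ^ n) * ∫⁻ t, ‖dampLine y g t‖ₑ ^ 2 =
      ∫⁻ t, ‖g t‖ₑ ^ 2 *
        ∫⁻ y in Ioi (0:ℝ), ENNReal.ofReal (y ^ n * Real.exp (-((4 * Real.pi * t) * y))) := by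
  have hm : AEMeasurable (Function.uncurry fun (y t : ℝ) =>
      ENNReal.ofReal (y ^ n) * ‖dampLine y g t‖ₑ ^ 2)
      ((volume.restrict (Ioi (0:ℝ))).prod volume) := by
    simp only [enorm_dampLine_sq, Function.uncurry_def]
    have := (hg.comp_snd (μ := volume.restrict (Ioi (0:ℝ)))).enorm
    fun_prop
  calc _ = ∫⁻ y in Ioi (0:ℝ), ∫⁻ t, ENNReal.ofReal (y ^ n) * ‖dampLine y g t‖ₑ ^ 2 := by
        refine lintegral_congr fun y => ?_
        rw [lintegral_const_mul' _ _ ENNReal.ofReal_ne_top]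
    _ = ∫⁻ t, ∫⁻ y in Ioi (0:ℝ), ENNReal.ofReal (y ^ n) * ‖dampLine y g t‖ₑ ^ 2 :=
        lintegral_lintegral_swap hm
    _ = _ := by
        refine lintegral_congr fun t => ?_
        rw [← lintegral_const_mul' _ _ (ENNReal.pow_ne_top enorm_ne_top)]
        refine setLIntegral_congr_fun measurableSet_Ioi fun y hy => ?_
        have : (0:ℝ) < y := hy
        rw [enorm_dampLine_sq, ENNReal.ofReal_mul (by positivity)]
        ring

/-- Members of the weighted space of densities corresponding to a Bergman space. -/
structure Density (N : ℕ) (g : ℝ → ℂ) : Prop where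
  meas : AEStronglyMeasurable g
  supp : ∀ t ≤ 0, g t = 0
  lt_top : ∫⁻ t, ‖g t / t ^ N‖ₑ ^ 2 < ∞

theorem enorm_div_pow_sq {g : ℝ → ℂ} (N : ℕ) {t : ℝ} (ht : 0 < t) :
    ‖g t / t ^ N‖ₑ ^ 2 = ‖g t‖ₑ ^ 2 * ENNReal.ofReal (1 / t ^ (2 * N)) := by
  rw [← ofReal_norm, ← ENNReal.ofReal_pow (norm_nonneg _), norm_div, norm_pow, norm_real,
    Real.norm_of_nonneg ht.le, div_pow, ← pow_mul, mul_comm N, div_eq_mul_one_div,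
    ENNReal.ofReal_mul (by positivity), ENNReal.ofReal_pow (norm_nonneg _), ofReal_norm]

/-- For `t > 0` the inner integral is `Γ(2N) / (4πt)^{2N}`; for `t ≤ 0` the density vanishes.
Positivity of `N` keeps the natural subtraction `2 * N - 1` honest. -/
theorem Density.lintegral_weight {N : ℕ} (hN : 0 < N) {g : ℝ → ℂ} (hs : ∀ t ≤ 0, g t = 0) :
    ∫⁻ t, ‖g t‖ₑ ^ 2 * ∫⁻ y in Ioi (0:ℝ),
        ENNReal.ofReal (y ^ (2 * N - 1) * Real.exp (-((4 * Real.pi * t) * y))) =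
      ENNReal.ofReal (Real.Gamma (2 * N) / (4 * Real.pi) ^ (2 * N)) *
        ∫⁻ t, ‖g t / t ^ N‖ₑ ^ 2 := by
  rw [← lintegral_const_mul' _ _ ENNReal.ofReal_ne_top]
  refine lintegral_congr fun t => ?_
  rcases le_or_gt t 0 with ht | ht
  · simp [hs t ht]
  · have h1 : 2 * N - 1 + 1 = 2 * N := by omega
    have h2 : ((2 * N - 1 : ℕ) : ℝ) + 1 = 2 * N := by
      rw [← Nat.cast_add_one, h1]; push_cast; rfl
    rw [lintegral_pow_mul_exp (by positivity : 0 < 4 * Real.pi * t), h1, h2,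
      enorm_div_pow_sq N ht, mul_left_comm, ← ENNReal.ofReal_mul
        (div_nonneg (Real.Gamma_nonneg_of_nonneg (by positivity)) (by positivity))]
    congr 2
    rw [mul_pow]
    field_simp

theorem Density.memLp {N : ℕ} {g : ℝ → ℂ} (hg : Density N g) :
    MemLp (fun t => g t / (t:ℂ) ^ N) 2 :=
  memLp_two_iff.2 ⟨(hg.meas.aemeasurable.div (by fun_prop : Measurable fun t : ℝ =>
    (t:ℂ) ^ N).aemeasurable).aestronglyMeasurable, hg.lt_top⟩

theorem pow_mul_exp_neg_le {N : ℕ} {a t : ℝ} (ha : 0 < a) (ht : 0 ≤ t) :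
    t ^ N * Real.exp (-(a * t)) ≤ N.factorial / a ^ N := by
  have h := Real.pow_div_factorial_le_exp (a * t) (by positivity) N
  rw [div_le_iff₀ (by positivity), mul_pow] at h
  rw [Real.exp_neg, ← div_eq_mul_inv, div_le_div_iff₀ (Real.exp_pos _) (by positivity)]
  linarith

/-- The factor `e^{-2πyt}` is split into two equal halves: one absorbs `t ^ N`, the other remains as
a bounded `L²` function multiplying `g / t ^ N`. This yields both integrability and square
integrability. -/
theorem Density.norm_dampLine_le {N : ℕ} {g : ℝ → ℂ} (hg : Density N g) {y : ℝ} (hy : 0 < y)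
    (t : ℝ) : ‖dampLine y g t‖ ≤ N.factorial / (Real.pi * y) ^ N *
      ‖((Ioi (0:ℝ)).indicator (fun t => (Real.exp (-(Real.pi * y * t)) : ℂ)) t) *
        (g t / (t:ℂ) ^ N)‖ := by
  rcases le_or_gt t 0 with ht | ht
  · simp [dampLine, hg.supp t ht]
  · rw [indicator_of_mem (mem_Ioi.2 ht), dampLine, norm_mul, norm_mul, norm_div, norm_pow, norm_real,
      norm_real, norm_real, Real.norm_of_nonneg ht.le, Real.norm_of_nonneg (Real.exp_pos _).le,
      Real.norm_of_nonneg (Real.exp_pos _).le]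
    have h1 := pow_mul_exp_neg_le (N := N) (by positivity : 0 < Real.pi * y) ht.le
    have h2 : Real.exp (-2 * Real.pi * y * t) =
        Real.exp (-(Real.pi * y * t)) * Real.exp (-(Real.pi * y * t)) := by
      rw [← Real.exp_add]; congr 1; ring
    calc Real.exp (-2 * Real.pi * y * t) * ‖g t‖
        = (t ^ N * Real.exp (-(Real.pi * y * t))) *
            (Real.exp (-(Real.pi * y * t)) * (‖g t‖ / t ^ N)) := by
          rw [h2]; field_simp
      _ ≤ _ := mul_le_mul_of_nonneg_right h1 (by positivity)

theorem memLp_exp_indicator {a : ℝ} (ha : 0 < a) :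
    MemLp ((Ioi (0:ℝ)).indicator fun t => (Real.exp (-(a * t)) : ℂ)) 2 := by
  refine memLp_two_iff.2 ⟨(by fun_prop : Continuous fun t : ℝ =>
    (Real.exp (-(a * t)) : ℂ)).aestronglyMeasurable.indicator measurableSet_Ioi, ?_⟩
  have h := lintegral_pow_mul_exp (n := 0) (r := 2 * a) (by positivity)
  refine lt_of_eq_of_lt ?_ (h.trans_lt ENNReal.ofReal_lt_top)
  rw [← lintegral_indicator measurableSet_Ioi]
  refine lintegral_congr fun t => ?_
  by_cases ht : t ∈ Ioi (0:ℝ)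
  · rw [indicator_of_mem ht, indicator_of_mem ht, ← ofReal_norm, norm_real,
      Real.norm_of_nonneg (Real.exp_pos _).le, ← ENNReal.ofReal_pow (Real.exp_pos _).le,
      ← Real.exp_nat_mul]
    congr 1
    rw [pow_zero, one_mul]
    congr 1
    push_cast; ring
  · simp [indicator_of_notMem ht]

theorem aestronglyMeasurable_dampLine (y : ℝ) {g : ℝ → ℂ} (hg : AEStronglyMeasurable g) :
    AEStronglyMeasurable (dampLine y g) :=
  (by fun_prop : Continuous fun t : ℝ =>
    (Real.exp (-2 * Real.pi * y * t) : ℂ)).aestronglyMeasurable.mul hg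

theorem Density.integrable_dampLine {N : ℕ} {g : ℝ → ℂ} (hg : Density N g) {y : ℝ} (hy : 0 < y) :
    Integrable (dampLine y g) := by
  have h := ((memLp_exp_indicator (by positivity : 0 < Real.pi * y)).integrable_mul
    hg.memLp).norm.const_mul (N.factorial / (Real.pi * y) ^ N)
  exact h.mono' (aestronglyMeasurable_dampLine y hg.meas)
    (ae_of_all _ fun t => hg.norm_dampLine_le hy t)

theorem Density.memLp_dampLine {N : ℕ} {g : ℝ → ℂ} (hg : Density N g) {y : ℝ} (hy : 0 < y) :
    MemLp (dampLine y g) 2 := by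
  refine hg.memLp.of_le_mul (c := N.factorial / (Real.pi * y) ^ N)
    (aestronglyMeasurable_dampLine y hg.meas) (ae_of_all _ fun t =>
      (hg.norm_dampLine_le hy t).trans ?_)
  refine mul_le_mul_of_nonneg_left ?_ (by positivity)
  rw [norm_mul]
  refine mul_le_of_le_one_left (norm_nonneg _) ?_
  by_cases ht : t ∈ Ioi (0:ℝ)
  · rw [indicator_of_mem ht, norm_real, Real.norm_of_nonneg (Real.exp_pos _).le,
      Real.exp_le_one_iff]
    have : (0:ℝ) < t := ht
    have := Real.pi_pos
    exact neg_nonpos.2 (by positivity)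
  · simp [indicator_of_notMem ht]

theorem rpow_weight (m : ℕ) {y : ℝ} :
    y ^ (4 * (m:ℝ) + 1) = y ^ (2 * (2 * m + 1) - 1) := by
  rw [← Real.rpow_natCast]
  congr 1
  rw [show 2 * (2 * m + 1) - 1 = 4 * m + 1 by omega]
  push_cast; ring

/-- The Bergman norm of a function represented by a density. -/
theorem Density.bergmanENorm_sq {m : ℕ} {g : ℝ → ℂ} (hg : Density (2 * m + 1) g) {G : ℂ → ℂ}
    (hG : ContinuousOn G upperHalf) (h : EqOn G (laplaceLine g) upperHalf) :
    bergmanENorm (4 * m + 1) G ^ 2 =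
      ENNReal.ofReal (Real.Gamma (4 * m + 2) / (4 * Real.pi) ^ (4 * m + 2)) *
        ∫⁻ t, ‖g t / t ^ (2 * m + 1)‖ₑ ^ 2 := by
  have e1 : (2 * ((2 * m + 1 : ℕ) : ℝ)) = 4 * m + 2 := by push_cast; ring
  have e2 : 2 * (2 * m + 1) = 4 * m + 2 := by ring
  have := Density.lintegral_weight (N := 2 * m + 1) (by omega) hg.supp
  rw [e1] at this
  rw [← e2, ← this, ← lintegral_pow_mul_dampLine _ hg.meas, LorentzHardy.bergmanENorm_sq _ hG]
  refine setLIntegral_congr_fun measurableSet_Ioi fun y hy => ?_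
  rw [rpow_weight, ← lintegral_enorm_sq_fourierInv (hg.integrable_dampLine hy)
    (hg.memLp_dampLine hy)]
  congr 1
  refine lintegral_congr fun x => ?_
  rw [h (by simpa [upperHalf] using hy), laplaceLine_add_mul_I]

theorem Density.continuousOn_laplaceLine {N : ℕ} {g : ℝ → ℂ} (hg : Density N g) :
    ContinuousOn (laplaceLine g) upperHalf := by
  intro z₀ hz₀
  have hz₀' : 0 < z₀.im := hz₀
  refine (continuousAt_of_dominated (bound := fun t => ‖dampLine (z₀.im / 2) g t‖) ?_ ?_
    (hg.integrable_dampLine (half_pos hz₀')).norm (ae_of_all _ fun t => ?_)).continuousWithinAt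
  · refine Filter.Eventually.of_forall fun z => ?_
    exact (by fun_prop : Continuous fun t : ℝ =>
      cexp (2 * Real.pi * I * (z * t))).aestronglyMeasurable.mul hg.meas
  · have : {z : ℂ | z₀.im / 2 < z.im} ∈ nhds z₀ :=
      (isOpen_lt continuous_const Complex.continuous_im).mem_nhds (half_lt_self hz₀')
    filter_upwards [this] with z hz
    refine ae_of_all _ fun t => ?_
    rcases le_or_gt t 0 with ht | ht
    · simp [dampLine, hg.supp t ht]
    · rw [dampLine, norm_mul, norm_mul, norm_real, Real.norm_of_nonneg (Real.exp_pos _).le,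
        Complex.norm_exp]
      refine mul_le_mul_of_nonneg_right (Real.exp_le_exp.2 ?_) (norm_nonneg _)
      have e : (2 * Real.pi * I * (z * t)).re = -(2 * Real.pi * t * z.im) := by
        simp; ring
      rw [e]
      have hz' : z₀.im / 2 < z.im := hz
      have := mul_le_mul_of_nonneg_left hz'.le (mul_pos Real.two_pi_pos ht).le
      linarith
  · fun_prop

/-! ### Paley–Wiener for the half-plane -/

section Bergman

variable {G : ℂ → ℂ}

theorem continuous_line (hG : DifferentiableOn ℂ G upperHalf) {y : ℝ} (hy : 0 < y) :
    Continuous fun x : ℝ => G (x + y * I) :=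
  hG.continuousOn.comp_continuous (by fun_prop) fun x => by simpa [upperHalf] using hy

theorem memLp_line (hG : DifferentiableOn ℂ G upperHalf) {y : ℝ} (hy : 0 < y)
    (hfin : ∫⁻ x : ℝ, ‖G (x + y * I)‖ₑ ^ 2 < ∞) : MemLp (fun x : ℝ => G (x + y * I)) 2 :=
  memLp_two_iff.2 ⟨(continuous_line hG hy).aestronglyMeasurable, hfin⟩

theorem lintegral_segment_lt_top {n : ℝ → ℝ≥0∞} {δ a b : ℝ} (hδ : ∫⁻ y in Ici δ, n y < ∞)
    (ha : δ ≤ a) (hb : δ ≤ b) (hab : a ≠ b) : ∫⁻ s in Ioc (0:ℝ) 1, n (a + s * (b - a)) < ∞ := by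
  have hba : b - a ≠ 0 := sub_ne_zero.2 hab.symm
  have h := lintegral_image_eq_lintegral_abs_deriv_mul (s := Ioc (0:ℝ) 1)
    (f := fun s => a + s * (b - a)) (f' := fun _ => b - a) measurableSet_Ioc
    (fun s _ => by
      simpa using (((hasDerivAt_id s).mul_const (b - a)).const_add a).hasDerivWithinAt)
    (fun s _ t _ hst => by
      simp only [add_right_inj] at hst
      exact mul_right_cancel₀ hba hst) n
  rw [lintegral_const_mul' _ _ ENNReal.ofReal_ne_top] at h
  have hsub : (fun s => a + s * (b - a)) '' Ioc (0:ℝ) 1 ⊆ Ici δ := by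
    rintro _ ⟨s, hs, rfl⟩
    simp only [mem_Ici]
    nlinarith [hs.1, hs.2]
  have h2 := (lintegral_mono_set (μ := volume) (f := n) hsub).trans_lt hδ
  rw [h] at h2
  by_contra hc
  rw [not_lt_top_iff] at hc
  rw [hc, ENNReal.mul_top (by simpa using hba)] at h2
  exact lt_irrefl _ h2

/-- Unlike in the Hardy case, no uniform bound on the lines is assumed; integrability of their
squared norms over heights bounded below replaces it. -/
theorem fourier_slice_line (hG : DifferentiableOn ℂ G upperHalf) {y₀ y : ℝ} (hy₀ : 0 < y₀)
    (hy : 0 < y) (hδ : ∫⁻ r in Ici (min y₀ y), ∫⁻ x : ℝ, ‖G (x + r * I)‖ₑ ^ 2 < ∞)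
    (h₀ : MemLp (fun x : ℝ => G (x + y₀ * I)) 2) (h₁ : MemLp (fun x : ℝ => G (x + y * I)) 2) :
    (𝓕 (h₁.toLp _) : Lp (α := ℝ) ℂ 2 volume) =ᵐ[volume] fun t =>
      (Real.exp (2 * Real.pi * (y₀ - y) * t) : ℂ) * (𝓕 (h₀.toLp _) : Lp (α := ℝ) ℂ 2 volume) t := by
  -- Equal heights are set apart because the change of variables onto the segment degenerates.
  by_cases hne : y₀ = y
  · subst hne; simp
  have hseg : ∀ s ∈ Icc (0:ℝ) 1, 0 < y₀ + s * (y - y₀) := fun s hs => by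
    have h1 : 0 < min y₀ y := lt_min hy₀ hy
    nlinarith [min_le_left y₀ y, min_le_right y₀ y, hs.1, hs.2]
  let Φ : ℝ → ℝ → ℂ := fun x s => G (x + (y₀ + s * (y - y₀) : ℝ) * I)
  have hΦ0 : (fun x => Φ x 0) = fun x : ℝ => G (x + y₀ * I) := by ext x; simp [Φ]
  have hΦ1 : (fun x => Φ x 1) = fun x : ℝ => G (x + y * I) := by ext x; simp [Φ]
  have hcont : ContinuousOn (Function.uncurry Φ) (univ ×ˢ Ioc 0 1) := by
    refine hG.continuousOn.comp (Continuous.continuousOn (by fun_prop)) fun q hq => ?_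
    simpa [upperHalf] using hseg q.2 ⟨hq.2.1.le, hq.2.2⟩
  have h := fourier_slice_eq (y - y₀) Φ (fun x => ?_) ?_
    (by rw [hΦ0]; exact continuous_line hG hy₀)
    (by rw [hΦ1]; exact continuous_line hG hy) (by rw [hΦ0]; exact h₀)
    (by rw [hΦ1]; exact h₁) ?_
  · simp only [hΦ0, hΦ1] at h
    filter_upwards [h] with t ht
    rw [ht, ← mul_assoc, ← ofReal_mul, ← Real.exp_add]
    have : 2 * Real.pi * (y₀ - y) * t + 2 * Real.pi * inner ℝ (y - y₀) t = 0 := by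
      simp only [RCLike.inner_apply, conj_trivial]; ring
    rw [this]; simp
  · simp only [Φ]
    have e : ∀ w : ℂ, ((x + w.re • (y - y₀) : ℝ) : ℂ) + (y₀ + w.im * (y - y₀) : ℝ) * I =
        x + y₀ * I + w * (y - y₀) := fun w => by
      simp only [smul_eq_mul]
      push_cast
      nth_rewrite 3 [← re_add_im w]
      ring
    simp only [e]
    refine hG.comp (by fun_prop) fun w hw => ?_
    rw [← e]
    simpa [upperHalf] using hseg _ hw
  · have hr : (volume : Measure ℝ).prod (volume.restrict (Ioc (0:ℝ) 1)) =
        (volume.prod volume).restrict (univ ×ˢ Ioc 0 1) := by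
      rw [← Measure.prod_restrict, Measure.restrict_univ]
    rw [hr]
    exact hcont.aestronglyMeasurable (MeasurableSet.univ.prod measurableSet_Ioc)
  · exact lintegral_segment_lt_top (n := fun r => ∫⁻ x : ℝ, ‖G (x + r * I)‖ₑ ^ 2) hδ
      (min_le_left _ _) (min_le_right _ _) hne

theorem lintegral_line_Ici_lt_top {n : ℕ} {N : ℝ → ℝ≥0∞}
    (h : ∫⁻ y in Ioi (0:ℝ), ENNReal.ofReal (y ^ n) * N y < ∞) {δ : ℝ} (hδ : 0 < δ) :
    ∫⁻ y in Ici δ, N y < ∞ := by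
  have h1 : ENNReal.ofReal (δ ^ n) * ∫⁻ y in Ici δ, N y < ∞ := by
    rw [← lintegral_const_mul' _ _ ENNReal.ofReal_ne_top]
    refine lt_of_le_of_lt ?_ h
    refine (setLIntegral_mono' measurableSet_Ici fun y hy => ?_).trans
      (lintegral_mono_set (Ici_subset_Ioi.2 hδ))
    gcongr
    exact hy
  by_contra hc
  rw [not_lt_top_iff] at hc
  rw [hc, ENNReal.mul_top (by simpa using pow_pos hδ n)] at h1
  exact lt_irrefl _ h1

/-- **Paley–Wiener theorem** for weighted Bergman spaces of the half-plane. -/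
theorem exists_density_of_memBergman {m : ℕ} (hG : MemBergman (4 * m + 1) G) :
    ∃ g : ℝ → ℂ, StronglyMeasurable g ∧ Density (2 * m + 1) g ∧
      EqOn G (laplaceLine g) upperHalf := by
  set n := 2 * (2 * m + 1) - 1 with hn
  set N : ℝ → ℝ≥0∞ := fun y => ∫⁻ x : ℝ, ‖G (x + y * I)‖ₑ ^ 2 with hN
  have hB : ∫⁻ y in Ioi (0:ℝ), ENNReal.ofReal (y ^ n) * N y < ∞ := by
    have h1 : bergmanENorm (4 * m + 1) G ^ 2 < ∞ := ENNReal.pow_lt_top hG.2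
    rw [bergmanENorm_sq _ hG.1.continuousOn] at h1
    simpa only [rpow_weight] using h1
  have hcont : ContinuousOn (fun p : ℝ × ℝ => G (p.2 + p.1 * I)) (Ioi (0:ℝ) ×ˢ univ) :=
    hG.1.continuousOn.comp (Continuous.continuousOn (by fun_prop)) fun p hp => by
      simpa [upperHalf] using hp.1
  have hNm : AEMeasurable N (volume.restrict (Ioi (0:ℝ))) := by
    have hr : ((volume : Measure ℝ).restrict (Ioi (0:ℝ))).prod (volume : Measure ℝ) =
        (volume.prod volume).restrict (Ioi (0:ℝ) ×ˢ univ) := by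
      rw [← Measure.prod_restrict, Measure.restrict_univ]
    have : AEMeasurable (fun p : ℝ × ℝ => ‖G (p.2 + p.1 * I)‖ₑ ^ 2)
        (((volume : Measure ℝ).restrict (Ioi (0:ℝ))).prod (volume : Measure ℝ)) := by
      rw [hr]
      exact (hcont.aestronglyMeasurable
        (measurableSet_Ioi.prod MeasurableSet.univ)).enorm.pow_const 2
    exact this.lintegral_prod_right'
  -- Finiteness of the Bergman norm gives `L²` control on almost every horizontal line; one of these
  -- serves as the reference height.
  have hfin : ∀ᵐ y ∂(volume.restrict (Ioi (0:ℝ))), 0 < y ∧ N y < ∞ := by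
    have hm : AEMeasurable (fun y => ENNReal.ofReal (y ^ n) * N y)
        (volume.restrict (Ioi (0:ℝ))) :=
      (by fun_prop : Measurable fun y : ℝ => ENNReal.ofReal (y ^ n)).aemeasurable.mul hNm
    filter_upwards [ae_lt_top' hm hB.ne, ae_restrict_mem measurableSet_Ioi] with y hy hy0
    refine ⟨hy0, ?_⟩
    by_contra hc
    rw [not_lt_top_iff] at hc
    rw [hc, ENNReal.mul_top (by simpa using pow_pos hy0 n)] at hy
    exact lt_irrefl _ hy
  have hne : (MeasureTheory.ae (volume.restrict (Ioi (0:ℝ)))).NeBot := by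
    rw [ae_neBot]
    intro h
    have := congrArg (fun μ : Measure ℝ => μ univ) h
    simp at this
  obtain ⟨y₀, hy₀, hN₀⟩ := hfin.exists
  have h₀ := memLp_line hG.1 hy₀ hN₀
  let H : Lp (α := ℝ) ℂ 2 volume := 𝓕 (h₀.toLp _)
  let f : ℝ → ℂ := fun t => (Real.exp (2 * Real.pi * y₀ * t) : ℂ) * H t
  have hfm : StronglyMeasurable f :=
    StronglyMeasurable.mul (Continuous.stronglyMeasurable (by fun_prop)) (Lp.stronglyMeasurable H)
  have hft : ∀ y (hy : 0 < y) (hNy : N y < ∞),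
      (𝓕 ((memLp_line hG.1 hy hNy).toLp _) : Lp (α := ℝ) ℂ 2 volume) =ᵐ[volume]
        dampLine y f := fun y hy hNy => by
    filter_upwards [fourier_slice_line hG.1 hy₀ hy
      (lintegral_line_Ici_lt_top hB (lt_min hy₀ hy)) h₀ (memLp_line hG.1 hy hNy)] with t ht
    rw [ht, dampLine, ← mul_assoc, ← ofReal_mul, ← Real.exp_add]
    congr 4
    ring
  have hnorm : ∀ y, 0 < y → N y < ∞ → ∫⁻ t, ‖dampLine y f t‖ₑ ^ 2 = N y := fun y hy hNy => by
    have e := lintegral_enorm_sq_fourier_Lp ((memLp_line hG.1 hy hNy).toLp _)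
    have e3 : ∫⁻ x : ℝ, ‖((memLp_line hG.1 hy hNy).toLp _ : Lp (α := ℝ) ℂ 2 volume) x‖ₑ ^ 2 =
        N y :=
      lintegral_congr_ae ((memLp_line hG.1 hy hNy).coeFn_toLp.mono fun t ht => by simp only [ht])
    rw [e3, lintegral_congr_ae (g := fun t => ‖dampLine y f t‖ₑ ^ 2)
      ((hft y hy hNy).mono fun t ht => by simp only [ht])] at e
    exact e
  have hW : ∫⁻ t, ‖f t‖ₑ ^ 2 * ∫⁻ y in Ioi (0:ℝ),
      ENNReal.ofReal (y ^ n * Real.exp (-((4 * Real.pi * t) * y))) < ∞ := by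
    rw [← lintegral_pow_mul_dampLine n hfm.aestronglyMeasurable]
    refine lt_of_eq_of_lt (lintegral_congr_ae ?_) hB
    filter_upwards [hfin] with y hy
    rw [hnorm y hy.1 hy.2]
  -- For `t ≤ 0` the weight in `hW` is infinite, so finiteness leaves no room for `f`.
  have hsupp : ∀ᵐ t, t ≤ 0 → f t = 0 := by
    have hm : AEMeasurable (fun t => ‖f t‖ₑ ^ 2 * ∫⁻ y in Ioi (0:ℝ),
        ENNReal.ofReal (y ^ n * Real.exp (-((4 * Real.pi * t) * y)))) := by
      refine (hfm.measurable.enorm.pow_const 2).aemeasurable.mul (Measurable.aemeasurable ?_)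
      exact (by fun_prop : Measurable fun p : ℝ × ℝ =>
        ENNReal.ofReal (p.2 ^ n * Real.exp (-((4 * Real.pi * p.1) * p.2)))).lintegral_prod_right'
    filter_upwards [ae_lt_top' hm hW.ne] with t ht ht0
    rw [lintegral_pow_mul_exp_eq_top
      (mul_nonpos_of_nonneg_of_nonpos (by positivity) ht0)] at ht
    by_contra hne
    rw [ENNReal.mul_top (by simpa using hne)] at ht
    exact lt_irrefl _ ht
  let g : ℝ → ℂ := (Ioi (0:ℝ)).indicator f
  have hgf : g =ᵐ[volume] f := hsupp.mono fun t ht => by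
    rcases le_or_gt t 0 with h | h
    · rw [ht h]; exact indicator_of_notMem (by simpa using h) f
    · exact indicator_of_mem (mem_Ioi.2 h) f
  have hgm : StronglyMeasurable g := hfm.indicator measurableSet_Ioi
  have hgs : ∀ t ≤ 0, g t = 0 := fun t ht => indicator_of_notMem (by simpa using ht) f
  have hg : Density (2 * m + 1) g := by
    refine ⟨hgm.aestronglyMeasurable, hgs, ?_⟩
    have h1 := Density.lintegral_weight (N := 2 * m + 1) (by omega) hgs
    have h2 : ∫⁻ t, ‖g t‖ₑ ^ 2 * ∫⁻ y in Ioi (0:ℝ),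
        ENNReal.ofReal (y ^ n * Real.exp (-((4 * Real.pi * t) * y))) < ∞ :=
      lt_of_eq_of_lt (lintegral_congr_ae (hgf.mono fun t ht => by simp only [ht])) hW
    rw [h1] at h2
    by_contra hc
    rw [not_lt_top_iff] at hc
    rw [hc, ENNReal.mul_top] at h2
    · exact lt_irrefl _ h2
    · have : 0 < Real.Gamma (2 * ((2 * m + 1 : ℕ) : ℝ)) :=
        Real.Gamma_pos_of_pos (by positivity)
      rw [Ne, ENNReal.ofReal_eq_zero, not_le]
      positivity
  have hae : ∀ᵐ y : ℝ ∂(volume.restrict (Ioi (0:ℝ))), ∀ x : ℝ,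
      G (x + y * I) = laplaceLine g (x + y * I) := by
    filter_upwards [hfin] with y ⟨hy, hNy⟩
    have hft' : (𝓕 ((memLp_line hG.1 hy hNy).toLp _) : Lp (α := ℝ) ℂ 2 volume) =ᵐ[volume]
        dampLine y g := by
      filter_upwards [hft y hy hNy, hgf] with t h1 h2
      rw [h1, dampLine, dampLine, h2]
    have hinv := ae_eq_fourierInv_of_fourier_ae_eq (memLp_line hG.1 hy hNy)
      (hg.integrable_dampLine hy) (hg.memLp_dampLine hy) hft'
    have hlap : 𝓕⁻ (dampLine y g) = fun x : ℝ => laplaceLine g (x + y * I) := by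
      ext x; rw [laplaceLine_add_mul_I]
    rw [hlap] at hinv
    have hc : Continuous fun x : ℝ => laplaceLine g (x + y * I) :=
      hg.continuousOn_laplaceLine.comp_continuous (by fun_prop) fun x => by
        simpa [upperHalf] using hy
    exact congrFun ((continuous_line hG.1 hy).ae_eq_iff_eq volume hc |>.1 hinv)
  refine ⟨g, hgm, hg, fun z hz => ?_⟩
  have hc : ∀ {K : ℂ → ℂ}, ContinuousOn K upperHalf →
      ContinuousOn (fun y : ℝ => K (z.re + y * I)) (Ioi 0) := fun hK =>
    hK.comp (Continuous.continuousOn (by fun_prop)) fun y hy => by simpa [upperHalf] using hy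
  -- Equality at almost every height extends to all heights by continuity in `y`.
  have := Measure.eqOn_open_of_ae_eq (hae.mono fun y hy => hy z.re) isOpen_Ioi
    (hc hG.1.continuousOn) (hc hg.continuousOn_laplaceLine) (mem_Ioi.2 hz)
  simpa using this

end Bergman

/-! ### Restriction as integration over discs, and the extension -/

/-- Polar coordinates, with antiderivative `-(t² - r²)^{k+1} / (2(k+1))`. It is used with `k = 2m`
for the estimate, `k = m` for the extension constant and `k = 0` for the area. -/
theorem integral_disc (k : ℕ) {t : ℝ} (ht : 0 ≤ t) :
    ∫ ζ in Metric.closedBall (0 : ℂ) t, (t ^ 2 - ‖ζ‖ ^ 2) ^ k =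
      Real.pi * t ^ (2 * k + 2) / (k + 1) := by
  have h := integral_fun_norm_addHaar (volume : Measure ℂ)
    ((Iic t).indicator fun r : ℝ => (t ^ 2 - r ^ 2) ^ k)
  have h1 : ∫ ζ in Metric.closedBall (0 : ℂ) t, (t ^ 2 - ‖ζ‖ ^ 2) ^ k =
      ∫ ζ : ℂ, (Iic t).indicator (fun r : ℝ => (t ^ 2 - r ^ 2) ^ k) ‖ζ‖ := by
    rw [← integral_indicator Metric.isClosed_closedBall.measurableSet]
    congr 1; ext ζ
    simp [indicator]
  have h2 : ∫ y in Ioi (0:ℝ), y ^ (Module.finrank ℝ ℂ - 1) •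
      (Iic t).indicator (fun r : ℝ => (t ^ 2 - r ^ 2) ^ k) y = t ^ (2 * k + 2) / (2 * (k + 1)) := by
    have e : ∀ y : ℝ, y ^ (Module.finrank ℝ ℂ - 1) •
        (Iic t).indicator (fun r : ℝ => (t ^ 2 - r ^ 2) ^ k) y =
        (Iic t).indicator (fun r : ℝ => r * (t ^ 2 - r ^ 2) ^ k) y := fun y => by
      by_cases hy : y ∈ Iic t
      · simp [hy, Complex.finrank_real_complex]
      · simp [hy]
    simp only [e]
    rw [setIntegral_indicator measurableSet_Iic, Ioi_inter_Iic,
      ← intervalIntegral.integral_of_le ht]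
    have hd : ∀ r ∈ uIcc 0 t, HasDerivAt
        (fun r : ℝ => -((t ^ 2 - r ^ 2) ^ (k + 1)) / (2 * (k + 1))) (r * (t ^ 2 - r ^ 2) ^ k) r :=
      fun r _ => by
        have := ((((hasDerivAt_id r).pow 2).const_sub (t ^ 2)).pow (k + 1)).neg.div_const
          (2 * ((k:ℝ) + 1))
        refine this.congr_deriv ?_
        have hk : (k:ℝ) + 1 ≠ 0 := by positivity
        simp only [id, Nat.add_sub_cancel]
        push_cast
        field_simp
        simp [mul_comm]
    rw [intervalIntegral.integral_eq_sub_of_hasDerivAt hd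
      (Continuous.intervalIntegrable (by fun_prop) _ _)]
    rw [sub_self, zero_pow (by omega)]
    ring
  rw [h1, h, h2, Complex.finrank_real_complex]
  have hv : (volume : Measure ℂ).real (Metric.ball 0 1) = Real.pi := by
    simp [Measure.real, Complex.volume_ball]
  rw [hv]
  have hk : (k:ℝ) + 1 ≠ 0 := by positivity
  simp only [smul_eq_mul, nsmul_eq_mul]
  push_cast
  field_simp

theorem lintegral_disc (k : ℕ) {t : ℝ} (ht : 0 ≤ t) :
    ∫⁻ ζ in Metric.closedBall (0 : ℂ) t, ENNReal.ofReal ((t ^ 2 - ‖ζ‖ ^ 2) ^ k) =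
      ENNReal.ofReal (Real.pi * t ^ (2 * k + 2) / (k + 1)) := by
  rw [← integral_disc k ht, ofReal_integral_eq_lintegral_ofReal]
  · exact (Continuous.continuousOn (by fun_prop)).integrableOn_compact
      (isCompact_closedBall (0:ℂ) t)
  · filter_upwards [ae_restrict_mem Metric.isClosed_closedBall.measurableSet] with ζ hζ
    rw [mem_closedBall_zero_iff] at hζ
    exact pow_nonneg (sub_nonneg.2 (pow_le_pow_left₀ (norm_nonneg _) hζ 2)) k

/-- At `(z, 0, 0)` the kernel does not depend on `ζ`, so Fubini integrates `f` over the fibres. -/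
theorem Adm.laplace_restrict {f : ℝ × ℂ → ℂ} (hf : Adm f) {z : ℂ} (hz : z ∈ upperHalf) :
    laplace f ![z, 0, 0] = laplaceLine (fun t => ∫ ζ, f (t, ζ)) z := by
  have hpt : ![z, 0, 0] = pt (z.re, 0) (z.im, 0) := by
    ext j
    fin_cases j
    · simp [pt, vec, mul_comm I]
    · simp [pt, vec]
    · simp [pt, vec]
  have hc : ((z.im, 0) : ℝ × ℂ) ∈ cone := by
    simp only [cone, mem_ofPred_eq, norm_zero]; exact hz
  have hi := hf.integrable_kern (z.re, 0) hc
  rw [← hpt] at hi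
  rw [laplace, Measure.volume_eq_prod, integral_prod _ hi, laplaceLine]
  congr 1; ext t
  rw [← integral_const_mul]
  congr 1; ext ζ
  simp [kern]

theorem differentiableOn_restrictFirst {F : (Fin 3 → ℂ) → ℂ}
    (hF : DifferentiableOn ℂ F (tubeDomain lorentzCone)) :
    DifferentiableOn ℂ (restrictFirst F) upperHalf := by
  refine hF.comp (g := F) (f := fun z : ℂ => ![z, 0, 0]) (Differentiable.differentiableOn ?_)
    fun z hz => ?_
  · rw [differentiable_pi]
    intro j
    fin_cases j
    · exact differentiable_id
    · exact differentiable_const _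
    · exact differentiable_const _
  · have hz' : 0 < z.im := hz
    simp [tubeDomain, lorentzCone, lorentzForm, hz']

/-- The density of `R □ᵐ F` when `F` is the Laplace transform of `f`. -/
noncomputable def boxDensity (m : ℕ) (f : ℝ × ℂ → ℂ) (t : ℝ) : ℂ :=
  ∫ ζ, (boxSymbol (t, ζ) : ℂ) ^ m * f (t, ζ)

theorem Adm.restrict_boxOp {f : ℝ × ℂ → ℂ} (hf : Adm f) {F : (Fin 3 → ℂ) → ℂ}
    (hF : EqOn F (laplace f) (tubeDomain lorentzCone)) (m : ℕ) :
    DifferentiableOn ℂ (restrictFirst (boxOp^[m] F)) upperHalf ∧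
      EqOn (restrictFirst (boxOp^[m] F)) (laplaceLine (boxDensity m f)) upperHalf := by
  obtain ⟨ha, he⟩ := hf.boxOp_iterate_laplace hF m
  refine ⟨differentiableOn_restrictFirst (ha.differentiableOn_laplace.congr he), fun z hz => ?_⟩
  have hz' : 0 < z.im := hz
  rw [restrictFirst, he (by simp [tubeDomain, lorentzCone, lorentzForm, hz']),
    ha.laplace_restrict hz]
  rfl

theorem boxDensity_of_nonpos (m : ℕ) {f : ℝ × ℂ → ℂ} (hs : ∀ p, p ∉ closedCone → f p = 0)
    {t : ℝ} (ht : t ≤ 0) : boxDensity m f t = 0 := by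
  refine integral_eq_zero_of_ae ?_
  -- At `t = 0` the fibre of the closed cone is the single point `0`: null, but not empty.
  have h0 : ∀ᵐ ζ : ℂ, ζ ≠ 0 := by simp [ae_iff]
  filter_upwards [h0] with ζ hζ
  rw [hs (t, ζ), mul_zero, Pi.zero_apply]
  exact not_le.2 (ht.trans_lt (norm_pos_iff.2 hζ))

theorem enorm_boxSymbol_pow_sq (m : ℕ) (t : ℝ) (ζ : ℂ) :
    ‖(boxSymbol (t, ζ) : ℂ) ^ m‖ₑ ^ 2 =
      ENNReal.ofReal ((2 * Real.pi) ^ (4 * m)) *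
        ENNReal.ofReal ((t ^ 2 - ‖ζ‖ ^ 2) ^ (2 * m)) := by
  rw [← ofReal_norm, ← ENNReal.ofReal_pow (norm_nonneg _), ← ENNReal.ofReal_mul (by positivity)]
  congr 1
  rw [norm_pow, norm_real, Real.norm_eq_abs, ← pow_mul, mul_comm m 2, pow_mul, sq_abs, boxSymbol,
    ← pow_mul, mul_pow, ← pow_mul, show 2 * (2 * m) = 4 * m by ring]

/-- Cauchy–Schwarz on the disc `‖ζ‖ ≤ t`, the only inequality behind the constant of part (1). -/
theorem enorm_boxDensity_sq_le (m : ℕ) {f : ℝ × ℂ → ℂ} (hm : StronglyMeasurable f)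
    (hs : ∀ p, p ∉ closedCone → f p = 0) {t : ℝ} (ht : 0 ≤ t) :
    ‖boxDensity m f t‖ₑ ^ 2 ≤
      ENNReal.ofReal ((2 * Real.pi) ^ (4 * m) * (Real.pi * t ^ (4 * m + 2) / (2 * m + 1))) *
        ∫⁻ ζ, ‖f (t, ζ)‖ₑ ^ 2 := by
  set B := Metric.closedBall (0 : ℂ) t
  have hB : MeasurableSet B := Metric.isClosed_closedBall.measurableSet
  have h1 : ‖boxDensity m f t‖ₑ ≤
      ∫⁻ ζ in B, (fun ζ => ‖(boxSymbol (t, ζ) : ℂ) ^ m‖ₑ) ζ * (fun ζ => ‖f (t, ζ)‖ₑ) ζ := by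
    refine (enorm_integral_le_lintegral_enorm _).trans_eq ?_
    rw [← lintegral_indicator hB]
    refine lintegral_congr fun ζ => ?_
    by_cases hζ : ζ ∈ B
    · rw [indicator_of_mem hζ, enorm_mul]
    · rw [indicator_of_notMem hζ, hs (t, ζ), mul_zero, enorm_zero]
      simpa [B, closedCone] using hζ
  have hfm : Measurable fun ζ => ‖f (t, ζ)‖ₑ := (hm.measurable.comp measurable_prodMk_left).enorm
  have hbm : Measurable fun ζ => ‖(boxSymbol (t, ζ) : ℂ) ^ m‖ₑ := by
    unfold boxSymbol; fun_prop
  have h2 := ENNReal.lintegral_mul_le_Lp_mul_Lq (volume.restrict B) Real.HolderConjugate.two_two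
    hbm.aemeasurable hfm.aemeasurable
  have h3 := pow_le_pow_left' (h1.trans h2) 2
  rw [mul_pow, pow_half_sq, pow_half_sq] at h3
  refine h3.trans ?_
  simp only [ENNReal.rpow_ofNat, enorm_boxSymbol_pow_sq]
  gcongr
  · rw [lintegral_const_mul' _ _ ENNReal.ofReal_ne_top, lintegral_disc (2 * m) ht,
      ← ENNReal.ofReal_mul (by positivity)]
    push_cast
    apply le_of_eq; congr 4; ring
  · exact Measure.restrict_le_self

theorem Density.of_boxDensity (m : ℕ) {f : ℝ × ℂ → ℂ} (hm : StronglyMeasurable f)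
    (hL2 : MemLp f 2) (hs : ∀ p, p ∉ closedCone → f p = 0) :
    Density (2 * m + 1) (boxDensity m f) ∧
      ∫⁻ t, ‖boxDensity m f t / (t:ℂ) ^ (2 * m + 1)‖ₑ ^ 2 ≤
        ENNReal.ofReal ((2 * Real.pi) ^ (4 * m) * (Real.pi / (2 * m + 1))) *
          ∫⁻ p, ‖f p‖ₑ ^ 2 := by
  have hb : ∫⁻ t, ‖boxDensity m f t / (t:ℂ) ^ (2 * m + 1)‖ₑ ^ 2 ≤
        ENNReal.ofReal ((2 * Real.pi) ^ (4 * m) * (Real.pi / (2 * m + 1))) *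
          ∫⁻ p, ‖f p‖ₑ ^ 2 := by
    rw [Measure.volume_eq_prod, lintegral_prod _ (hm.measurable.enorm.pow_const 2).aemeasurable,
      ← lintegral_const_mul' _ _ ENNReal.ofReal_ne_top]
    refine lintegral_mono fun t => ?_
    rcases le_or_gt t 0 with ht | ht
    · simp [boxDensity_of_nonpos m hs ht]
    · simp only
      rw [enorm_div_pow_sq _ ht, mul_comm]
      refine (mul_le_mul_right (enorm_boxDensity_sq_le m hm hs ht.le) _).trans_eq ?_
      rw [← mul_assoc, ← ENNReal.ofReal_mul (by positivity)]
      congr 2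
      rw [show 2 * (2 * m + 1) = 4 * m + 2 by ring]
      field_simp
  refine ⟨⟨?_, fun t ht => boxDensity_of_nonpos m hs ht, hb.trans_lt
    (ENNReal.mul_lt_top ENNReal.ofReal_lt_top (memLp_two_iff.1 hL2).2)⟩, hb⟩
  have : StronglyMeasurable fun p : ℝ × ℂ => (boxSymbol p : ℂ) ^ m * f p :=
    (Continuous.stronglyMeasurable (by unfold boxSymbol; fun_prop)).mul hm
  exact this.integral_prod_right'.aestronglyMeasurable

/-- The density on the cone whose Laplace transform extends the function with density `g`. -/
noncomputable def extension (m : ℕ) (g : ℝ → ℂ) : ℝ × ℂ → ℂ :=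
  closedCone.indicator fun p =>
    (((m + 1) / (Real.pi * (2 * Real.pi) ^ (2 * m)) : ℝ) : ℂ) * (g p.1 / (p.1:ℂ) ^ (2 * m + 2))

theorem stronglyMeasurable_extension (m : ℕ) {g : ℝ → ℂ} (hg : StronglyMeasurable g) :
    StronglyMeasurable (extension m g) := by
  have := hg.measurable
  refine (Measurable.stronglyMeasurable ?_).indicator isClosed_closedCone.measurableSet
  fun_prop

/-- The constant and the power `t^{2m+2}` in `extension` are exactly what the integral of the symbol
over the disc produces. -/
theorem boxDensity_extension {m : ℕ} {g : ℝ → ℂ} (hg : ∀ t ≤ 0, g t = 0) :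
    boxDensity m (extension m g) = g := by
  ext t
  rcases le_or_gt t 0 with ht | ht
  · rw [hg t ht]
    exact boxDensity_of_nonpos m (fun p hp => indicator_of_notMem hp _) ht
  · set c : ℝ := (m + 1) / (Real.pi * (2 * Real.pi) ^ (2 * m)) with hc
    have e : ∀ ζ : ℂ, (boxSymbol (t, ζ) : ℂ) ^ m * extension m g (t, ζ) =
        (Metric.closedBall (0:ℂ) t).indicator (fun ζ => (((t ^ 2 - ‖ζ‖ ^ 2) ^ m : ℝ) : ℂ) *
          (((2 * Real.pi) ^ (2 * m) * c : ℝ) * (g t / (t:ℂ) ^ (2 * m + 2)))) ζ := fun ζ => by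
      by_cases hζ : ζ ∈ Metric.closedBall (0:ℂ) t
      · have hp : (t, ζ) ∈ closedCone := by simpa [closedCone] using hζ
        rw [indicator_of_mem hζ, extension, indicator_of_mem hp, ← hc, boxSymbol]
        push_cast
        rw [mul_pow, ← pow_mul]
        ring
      · have hp : (t, ζ) ∉ closedCone := by simpa [closedCone] using hζ
        rw [indicator_of_notMem hζ, extension, indicator_of_notMem hp, mul_zero]
    rw [boxDensity]
    simp only [e]
    rw [integral_indicator Metric.isClosed_closedBall.measurableSet, integral_mul_const,
      integral_complex_ofReal, integral_disc m ht.le, hc]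
    have ht' : (t:ℂ) ≠ 0 := ofReal_ne_zero.2 ht.ne'
    have hm : (m:ℂ) + 1 ≠ 0 := by exact_mod_cast (Nat.succ_ne_zero m)
    have hpi : (Real.pi : ℂ) ≠ 0 := ofReal_ne_zero.2 Real.pi_ne_zero
    push_cast
    field_simp

/-- The extension is constant on each disc, whose area `π t²` turns the weight `t^{-(4m+4)}` into
`t^{-(4m+2)}`, the one in the Bergman norm. -/
theorem lintegral_extension (m : ℕ) {g : ℝ → ℂ} (hg : StronglyMeasurable g)
    (hs : ∀ t ≤ 0, g t = 0) :
    ∫⁻ p, ‖extension m g p‖ₑ ^ 2 =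
      ENNReal.ofReal (((m + 1) / (Real.pi * (2 * Real.pi) ^ (2 * m))) ^ 2 * Real.pi) *
        ∫⁻ t, ‖g t / (t:ℂ) ^ (2 * m + 1)‖ₑ ^ 2 := by
  rw [Measure.volume_eq_prod, lintegral_prod _
    ((stronglyMeasurable_extension m hg).measurable.enorm.pow_const 2).aemeasurable,
    ← lintegral_const_mul' _ _ ENNReal.ofReal_ne_top]
  refine lintegral_congr fun t => ?_
  set c : ℝ := (m + 1) / (Real.pi * (2 * Real.pi) ^ (2 * m)) with hc
  rcases le_or_gt t 0 with ht | ht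
  · have : ∀ ζ, extension m g (t, ζ) = 0 := fun ζ => by
      simp [extension, indicator, hs t ht]
    simp [this, hs t ht]
  · have e : ∀ ζ : ℂ, ‖extension m g (t, ζ)‖ₑ ^ 2 = (Metric.closedBall (0:ℂ) t).indicator
        (fun _ => ‖(c : ℂ) * (g t / (t:ℂ) ^ (2 * m + 2))‖ₑ ^ 2) ζ := fun ζ => by
      by_cases hζ : ζ ∈ Metric.closedBall (0:ℂ) t
      · have hp : (t, ζ) ∈ closedCone := by simpa [closedCone] using hζ
        rw [indicator_of_mem hζ, extension, indicator_of_mem hp]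
      · have hp : (t, ζ) ∉ closedCone := by simpa [closedCone] using hζ
        rw [indicator_of_notMem hζ, extension, indicator_of_notMem hp]
        simp
    have hv : (volume : Measure ℂ) (Metric.closedBall 0 t) = ENNReal.ofReal (Real.pi * t ^ 2) := by
      have := lintegral_disc 0 ht.le
      simpa using this
    simp only [e]
    rw [lintegral_indicator Metric.isClosed_closedBall.measurableSet, setLIntegral_const, hv,
      ← ofReal_norm, ← ofReal_norm, ← ENNReal.ofReal_pow (norm_nonneg _),
      ← ENNReal.ofReal_pow (norm_nonneg _), ← ENNReal.ofReal_mul (by positivity),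
      ← ENNReal.ofReal_mul (by positivity)]
    congr 1
    rw [norm_mul, norm_div, norm_div, norm_pow, norm_pow, norm_real, norm_real,
      Real.norm_of_nonneg ht.le, Real.norm_of_nonneg (by positivity : 0 ≤ c)]
    field_simp
    ring

end LorentzHardy

/-! ### Assembly of the constants -/

open LorentzHardy MeasureTheory in
theorem mainTheorem8 (m : ℕ) :
    (∀ F : (Fin 3 → ℂ) → ℂ, MemHardy lorentzCone F →
      MemBergman (4 * m + 1) (restrictFirst (boxOp^[m] F)) ∧
      bergmanENorm (4 * m + 1) (restrictFirst (boxOp^[m] F)) ^ 2 ≤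
        ENNReal.ofReal (Real.Gamma (4 * m + 2) / (2 ^ (4 * m + 4) * Real.pi * (2 * m + 1))) *
          hardyENorm lorentzCone F ^ 2) ∧
    (∀ G : ℂ → ℂ, MemBergman (4 * m + 1) G →
      ∃ F : (Fin 3 → ℂ) → ℂ, MemHardy lorentzCone F ∧
        Set.EqOn (restrictFirst (boxOp^[m] F)) G upperHalf ∧
        hardyENorm lorentzCone F =
          ENNReal.ofReal (2 ^ (2 * m + 2) * (m + 1) * √(Real.pi / Real.Gamma (4 * m + 2))) *
            bergmanENorm (4 * m + 1) G) := by
  have hΓ : 0 < Real.Gamma (4 * m + 2) := Real.Gamma_pos_of_pos (by positivity)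
  have hpi := Real.pi_pos
  refine ⟨fun F hF => ?_, fun G hG => ?_⟩
  · obtain ⟨f, hm, hL2, hs, hFf, hle⟩ := exists_laplace_of_memHardy hF
    obtain ⟨hd, he⟩ := (Adm.of_memLp hL2 hs).restrict_boxOp hFf m
    obtain ⟨hg, hb⟩ := Density.of_boxDensity m hm hL2 hs
    have hle2 : bergmanENorm (4 * m + 1) (restrictFirst (boxOp^[m] F)) ^ 2 ≤
        ENNReal.ofReal (Real.Gamma (4 * m + 2) / (2 ^ (4 * m + 4) * Real.pi * (2 * m + 1))) *
          hardyENorm lorentzCone F ^ 2 := by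
      rw [hg.bergmanENorm_sq hd.continuousOn he]
      refine (mul_le_mul_right (hb.trans (mul_le_mul_right hle _)) _).trans_eq ?_
      rw [← mul_assoc, ← ENNReal.ofReal_mul (by positivity)]
      congr 2
      rw [show (4 * Real.pi) ^ (4 * m + 2) =
        2 ^ (4 * m + 4) * (2 * Real.pi) ^ (4 * m) * Real.pi ^ 2 by
          rw [show 4 * Real.pi = 2 * (2 * Real.pi) by ring, mul_pow]; ring]
      field_simp
    refine ⟨⟨hd, ?_⟩, hle2⟩
    exact (ENNReal.pow_lt_top_iff.1 (hle2.trans_lt (ENNReal.mul_lt_top ENNReal.ofReal_lt_top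
      (ENNReal.pow_lt_top hF.2)))).resolve_right two_ne_zero
  · obtain ⟨g, hgm, hg, hGg⟩ := exists_density_of_memBergman hG
    have hnorm := lintegral_extension m hgm hg.supp
    have hs : ∀ p, p ∉ closedCone → extension m g p = 0 := fun p hp => Set.indicator_of_notMem hp _
    have hL2 : MemLp (extension m g) 2 := by
      refine memLp_two_iff.2 ⟨(stronglyMeasurable_extension m hgm).aestronglyMeasurable, ?_⟩
      rw [hnorm]
      exact ENNReal.mul_lt_top ENNReal.ofReal_lt_top hg.lt_top
    obtain ⟨hH, hHn⟩ := memHardy_laplace hL2 hs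
    refine ⟨laplace (extension m g), hH, ?_, ?_⟩
    · have he := ((Adm.of_memLp hL2 hs).restrict_boxOp (fun z _ => rfl) m).2
      rw [boxDensity_extension hg.supp] at he
      exact he.trans hGg.symm
    -- Squaring is injective on `[0, ∞]`, so the norm identity may be checked on the squared norms
    -- already computed.
    · refine (ENNReal.pow_right_strictMono two_ne_zero).injective ?_
      rw [hHn, hnorm, mul_pow (ENNReal.ofReal _), hg.bergmanENorm_sq hG.1.continuousOn hGg, ← mul_assoc,
        ← ENNReal.ofReal_pow (by positivity), ← ENNReal.ofReal_mul (by positivity)]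
      congr 2
      rw [mul_pow _ (√_), Real.sq_sqrt (by positivity), show (4 * Real.pi) ^ (4 * m + 2) =
        (2 ^ (2 * m + 2)) ^ 2 * ((2 * Real.pi) ^ (2 * m)) ^ 2 * Real.pi ^ 2 by
          rw [show 4 * Real.pi = 2 * (2 * Real.pi) by ring, mul_pow]; ring]
      field_simp
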